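/- Let $A, B \in \mathbb{Z}$ with $4A^3+27B^2 \neq 0$, let $E$ be the elliptic curve $y^2 = x^3+Ax+B$ over $\mathbb{Q}$, and let $N_E$ be its conductor. Put \[ F(x,z) = x^3+Axz^2+Bz^3, \qquad Q(u,v,w) = v\,F(u,vw^2). \] Let $c_1, c_2$ be arbitrary real numbers. (In the application they are constants depending only on $A, B$ with $c_1 < \hat h_{E_d}(P) - \tfrac12 h_x(P) < c_2$ for all square-free $d$ and all $P \in E_d(\mathbb{Q})$, where $E_d : dy^2 = x^3+Ax+B$, $\hat h_{E_d}$ is the canonical height and $h_x$ the logarithmic height of the $x$-coordinate.) For $\alpha > 0$ let \[ \mathcal{R}_Q(\alpha) = \{ (u,v,w) \in \mathbb{R}_{\geq 1}^3 : Q(u,v,w) > 0,\ \mathrm{e}^{-2c_1} \leq \max\{u,vw^2\} \leq \mathrm{e}^{-2c_2} Q(u,v,w)^{1/4+2\alpha} \}, \] and for an integer $d \geq 1$ let \[ r_Q(\alpha;d) = \#\{ (u,v,w) \in \mathbb{Z}^3 \cap \mathcal{R}_Q(\alpha) : Q(u,v,w) = d \}. \] For $a \in (\mathbb{Z}/4N_E\mathbb{Z})^\times$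 and $X \geq 1$ let \[ S_Q(a;\alpha;X) = \sum_{\substack{1 \leq d \leq X,\ d \text{ square-free} \\ d \equiv a \bmod 4N_E}} r_Q(\alpha;d). \] Then for every $\alpha \in (0,1/56)$ there exist $C > 0$ and $X_0$, depending only on $\alpha, A, B, c_1, c_2$, such that for every $a \in (\mathbb{Z}/4N_E\mathbb{Z})^\times$ and every real $X \geq X_0$, \[ S_Q(a;\alpha;X) \geq C\, X^{1/2} \log X. \] -/

import Mathlib

noncomputable section

namespace SquarefreeTwist

/-! ### The conductor of an elliptic curve over `ℚ` -/

section Conductor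

variable {p : ℕ} [Fact p.Prime]

/-- The field `ℚ_p(E[ℓ])`, generated over `ℚ_p` inside an algebraic closure by the coordinates of
the (affine) `ℓ`-torsion points of `W`. -/
def divisionField (W : WeierstrassCurve ℚ_[p]) (ℓ : ℕ) :
    IntermediateField ℚ_[p] (AlgebraicClosure ℚ_[p]) :=
  letI := Classical.decEq (AlgebraicClosure ℚ_[p])
  IntermediateField.adjoin ℚ_[p]
    {z | ∃ (x y : AlgebraicClosure ℚ_[p])
      (h : (W.baseChange (AlgebraicClosure ℚ_[p])).toAffine.Nonsingular x y),
      ℓ • (WeierstrassCurve.Affine.Point.some x y h) = 0 ∧ (z = x ∨ z = y)}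

/-- The maximal ideal of the ring of integers of a finite extension `L` of `ℚ_p`: the only prime
above `p`, that is, the radical of the ideal generated by `p`. -/
def maxIdeal (L : IntermediateField ℚ_[p] (AlgebraicClosure ℚ_[p])) :
    Ideal (integralClosure ℤ_[p] L) :=
  (Ideal.span {(p : integralClosure ℤ_[p] L)}).radical

/-- The `i`-th ramification group of `L / ℚ_p` in the lower numbering: the automorphisms that act
trivially on the ring of integers of `L` modulo the `(i+1)`-st power of its maximal ideal. -/
def ramificationGroup (L : IntermediateField ℚ_[p] (AlgebraicClosure ℚ_[p])) (i : ℕ) :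
    Set (L ≃ₐ[ℚ_[p]] L) :=
  {σ | ∀ x : integralClosure ℤ_[p] L, ∃ y ∈ maxIdeal L ^ (i + 1), (y : L) = σ (x : L) - (x : L)}

/-- The group of `ℓ`-torsion points of `W` over `L` that are fixed by all automorphisms in `S`. -/
def fixedTorsion (W : WeierstrassCurve ℚ_[p]) (ℓ : ℕ)
    (L : IntermediateField ℚ_[p] (AlgebraicClosure ℚ_[p])) (S : Set (L ≃ₐ[ℚ_[p]] L)) :
    letI := Classical.decEq L
    AddSubgroup (W.baseChange L).toAffine.Point :=
  letI := Classical.decEq L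
  { carrier := {P | ℓ • P = 0 ∧
      ∀ σ ∈ S, WeierstrassCurve.Affine.Point.map (W' := W) (σ : L →ₐ[ℚ_[p]] L) P = P}
    zero_mem' := ⟨smul_zero _, fun _ _ => map_zero _⟩
    add_mem' := fun {P Q} hP hQ =>
      ⟨by rw [smul_add, hP.1, hQ.1, add_zero],
        fun σ hσ => by rw [map_add, hP.2 σ hσ, hQ.2 σ hσ]⟩
    neg_mem' := fun {P} hP =>
      ⟨by rw [smul_neg, hP.1, neg_zero], fun σ hσ => by rw [map_neg, hP.2 σ hσ]⟩ }

/-- The dimension over `𝔽_ℓ` of `E[ℓ] / E[ℓ]^{G_i}`, where `G_i` is the `i`-th ramification group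
of `ℚ_p(E[ℓ]) / ℚ_p`. The index of `E[ℓ]^{G_i}` in `E[ℓ]` is `ℓ` to the power of that dimension. -/
def torsionCodim (W : WeierstrassCurve ℚ_[p]) (ℓ i : ℕ) : ℕ :=
  letI := Classical.decEq (divisionField W ℓ)
  Nat.log ℓ ((fixedTorsion W ℓ (divisionField W ℓ)
    (ramificationGroup (divisionField W ℓ) i)).relIndex
      (fixedTorsion W ℓ (divisionField W ℓ) ∅))

/-- The wild part `∑_{i ≥ 1} (#G_i / #G_0) dim (E[ℓ] / E[ℓ]^{G_i})` of the conductor exponent of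
`W` at `p`; here `ℓ` is a prime different from `p`. The value does not depend on `ℓ`. -/
def wildPart (W : WeierstrassCurve ℚ_[p]) (ℓ : ℕ) : ℚ :=
  ∑ᶠ i : ℕ, ((ramificationGroup (divisionField W ℓ) (i + 1)).ncard : ℚ) /
    ((ramificationGroup (divisionField W ℓ) 0).ncard : ℚ) * (torsionCodim W ℓ (i + 1) : ℚ)

open scoped Classical in
/-- The tame part of the conductor exponent of `W` at `p`: `0`, `1` or `2` according as a minimal
model of `W` has good, multiplicative or additive reduction. -/
def tamePart (W : WeierstrassCurve ℚ_[p]) : ℕ :=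
  if (W.minimal ℤ_[p]).HasGoodReduction ℤ_[p] then 0
  else if (W.minimal ℤ_[p]).HasMultiplicativeReduction ℤ_[p] then 1
  else 2

/-- The conductor exponent of `W` at `p`, the sum of its tame and wild parts. The wild part is a
nonnegative integer, so that taking its integer part only changes its type; the auxiliary prime
is `2` for odd `p` and `3` for `p = 2`. -/
def conductorExponent (W : WeierstrassCurve ℚ_[p]) : ℕ :=
  tamePart W + ⌊wildPart W (if p = 2 then 3 else 2)⌋₊

end Conductor

/-- The conductor `∏_p p ^ f_p` of an elliptic curve over `ℚ`. -/
def conductor (E : WeierstrassCurve ℚ) : ℕ :=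
  ∏ᶠ p : Nat.Primes,
    haveI : Fact (p : ℕ).Prime := ⟨p.2⟩
    (p : ℕ) ^ conductorExponent (E.baseChange ℚ_[p])

/-- The elliptic curve `y ^ 2 = x ^ 3 + A x + B` over `ℚ`. -/
def curve (A B : ℤ) : WeierstrassCurve ℚ := ⟨0, 0, 0, A, B⟩

/-! ### The polynomial `Q` and the counting functions -/

/-- The binary cubic form `F(x, z) = x ^ 3 + A x z ^ 2 + B z ^ 3`. -/
def F {R : Type*} [CommRing R] (A B : ℤ) (x z : R) : R :=
  x ^ 3 + (A : R) * x * z ^ 2 + (B : R) * z ^ 3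

/-- The polynomial `Q(u, v, w) = v F(u, v w ^ 2)`. -/
def Q {R : Type*} [CommRing R] (A B : ℤ) (u v w : R) : R :=
  v * F A B u (v * w ^ 2)

/-- The region `ℛ_Q(α)`. The positivity of `Q` is implicit in its being raised to a real power. -/
def region (A B : ℤ) (c₁ c₂ α : ℝ) : Set (ℝ × ℝ × ℝ) :=
  {t | 1 ≤ t.1 ∧ 1 ≤ t.2.1 ∧ 1 ≤ t.2.2 ∧
    0 < Q A B t.1 t.2.1 t.2.2 ∧
    Real.exp (-2 * c₁) ≤ max t.1 (t.2.1 * t.2.2 ^ 2) ∧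
    max t.1 (t.2.1 * t.2.2 ^ 2) ≤
      Real.exp (-2 * c₂) * Q A B t.1 t.2.1 t.2.2 ^ (1 / 4 + 2 * α)}

/-- The number `r_Q(α; d)` of integral points `(u, v, w)` of `ℛ_Q(α)` with `Q(u, v, w) = d`. -/
def rQ (A B : ℤ) (c₁ c₂ α : ℝ) (d : ℕ) : ℕ :=
  Set.ncard {t : ℤ × ℤ × ℤ |
    ((t.1 : ℝ), (t.2.1 : ℝ), (t.2.2 : ℝ)) ∈ region A B c₁ c₂ α ∧ Q A B t.1 t.2.1 t.2.2 = (d : ℤ)}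

open scoped Classical in
/-- The sum `S_Q(a; α; X)` of `r_Q(α; d)` over the square-free integers `1 ≤ d ≤ X` with
`d ≡ a mod 4 N_E`. -/
def SQ (A B : ℤ) (c₁ c₂ : ℝ) (a : ZMod (4 * conductor (curve A B))) (α X : ℝ) : ℕ :=
  ∑ d ∈ (Finset.Icc 1 ⌊X⌋₊).filter
    (fun d : ℕ => Squarefree d ∧ (d : ZMod (4 * conductor (curve A B))) = a), rQ A B c₁ c₂ α d

end SquarefreeTwist

end

/-! Restrict to `u ≡ 1`, `v ≡ b`, `w ≡ 0` modulo a fixed multiple `M` of `4 N_E`, with `b` a lift of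
`a` prime to `M`. Then `Q ≡ b` modulo `M`: the congruence on `d` is automatic and no prime factor of
`M` divides `Q`. Take boxes with `u` of order `I`, `v` of order `J` and `w` up to order `K`, where
`J K²` is at most a small multiple of `I`. There `F(u, v w²)` is `u³` up to a factor 2, so `Q` has
order `J I³`. If `J I³` has order `X` and `K` has order `√(I/J)`, the box holds about `√(I³ J)`,
that is, order `√X` triples. Each power of two `J` between `X^(1/4-2α)` and `X^(1/4-α)` gives such a
box (`exists_lengths`); these boxes are disjoint and their number has order `log X`
(`exists_dyadic`). Since `I ≤ X^(1/4+2α/3)`, the height condition holds with a power of `X` to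
spare.

It remains to see that `Q` is square-free at a quarter of each box (`exists_card_sqfreeTriples_ge`),
by a union bound over primes (`notSqfree_subset`). The hard case is `p² ∣ F(u, v w²)`, as `p` can be
as large as `I^(3/2)`. For `p ≤ √I`, fix `v` and `w` and count `u` modulo `p²`. For larger `p`, fix
only `w` and a root modulo `p`: the points `(u, v)` then have pairwise determinants divisible by
`p²`, and primitive points of this kind have well-spaced slopes (`card_le_of_pairwise_dvd_det`). The
total loss `K I^(3/2)` is small against `I J K` because `J` exceeds a large multiple of `√I`. -/

namespace SquarefreeTwist

open Finset

/-! ### The cubic form modulo squares of primes -/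

/-- A Bézout relation between `F(·, z)` and its derivative: away from the discriminant and `z`,
roots modulo `p` are simple. -/
lemma resultant_identity (A B r z : ℤ) :
    (-18 * A * r + 27 * B * z) * F A B r z
      + (6 * A * r ^ 2 - 9 * B * r * z + 4 * A ^ 2 * z ^ 2) * (3 * r ^ 2 + A * z ^ 2)
      = (4 * A ^ 3 + 27 * B ^ 2) * z ^ 4 := by
  simp only [F, Int.cast_id]; ring

/-- Roots of `F(·, z)` modulo `p ^ 2` that agree modulo `p` agree modulo `p ^ 2`. -/
lemma sq_dvd_sub_of_roots {A B p r s z : ℤ} (hp : Prime p) (hD : ¬ p ∣ 4 * A ^ 3 + 27 * B ^ 2)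
    (hz : ¬ p ∣ z) (hr : p ^ 2 ∣ F A B r z) (hs : p ^ 2 ∣ F A B s z) (hrs : p ∣ r - s) :
    p ^ 2 ∣ r - s := by
  have key : F A B r z - F A B s z = (r - s) * (r ^ 2 + r * s + s ^ 2 + A * z ^ 2) := by
    simp only [F, Int.cast_id]; ring
  -- The cofactor is congruent to the derivative at `r` modulo `p`, hence is prime to `p`: the
  -- uniqueness half of Hensel's lemma.
  have hG : ¬ p ∣ r ^ 2 + r * s + s ^ 2 + A * z ^ 2 := by
    intro hG
    have h1 : p ∣ 3 * r ^ 2 + A * z ^ 2 := by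
      have : 3 * r ^ 2 + A * z ^ 2
          = (r ^ 2 + r * s + s ^ 2 + A * z ^ 2) + (r - s) * (2 * r + s) := by ring
      rw [this]
      exact dvd_add hG (hrs.mul_right _)
    have h2 : p ∣ F A B r z := (dvd_pow_self p two_ne_zero).trans hr
    have h3 := dvd_add (h2.mul_left (-18 * A * r + 27 * B * z))
      (h1.mul_left (6 * A * r ^ 2 - 9 * B * r * z + 4 * A ^ 2 * z ^ 2))
    rw [resultant_identity] at h3
    rcases hp.dvd_or_dvd h3 with h | h
    · exact hD h
    · exact hz (hp.dvd_of_dvd_pow h)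
  exact hp.pow_dvd_of_dvd_mul_right 2 hG (key ▸ dvd_sub hr hs)

/-- Two points of `F = 0` modulo `p ^ 2` that are proportional modulo `p` are proportional
modulo `p ^ 2`. -/
lemma sq_dvd_det_of_roots {A B p u z u' z' : ℤ} (hp : Prime p)
    (hD : ¬ p ∣ 4 * A ^ 3 + 27 * B ^ 2) (hz : ¬ p ∣ z) (hz' : ¬ p ∣ z')
    (hu : p ^ 2 ∣ F A B u z) (hu' : p ^ 2 ∣ F A B u' z') (h : p ∣ u * z' - u' * z) :
    p ^ 2 ∣ u * z' - u' * z := by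
  -- By homogeneity `u z'` and `u' z` are both roots of `F(·, z z')`.
  refine sq_dvd_sub_of_roots (z := z * z') hp hD (fun h => ?_) ?_ ?_ h
  · exact (hp.dvd_or_dvd h).elim hz hz'
  · have : F A B (u * z') (z * z') = z' ^ 3 * F A B u z := by
      simp only [F, Int.cast_id]; ring
    exact this ▸ hu.mul_left _
  · have : F A B (u' * z) (z * z') = z ^ 3 * F A B u' z' := by
      simp only [F, Int.cast_id]; ring
    exact this ▸ hu'.mul_left _

/-- The roots of `x ^ 3 + A x + B` modulo `p`. -/
def cubicRoots (A B : ℤ) (p : ℕ) [NeZero p] : Finset (ZMod p) :=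
  univ.filter fun x => x ^ 3 + (A : ZMod p) * x + (B : ZMod p) = 0

lemma card_cubicRoots_le (A B : ℤ) (p : ℕ) [Fact p.Prime] : #(cubicRoots A B p) ≤ 3 := by
  classical
  let f : Polynomial (ZMod p) :=
    Polynomial.X ^ 3 + (Polynomial.C (A : ZMod p) * Polynomial.X + Polynomial.C (B : ZMod p))
  have hdeg : f.natDegree = 3 := by
    simp only [f]; compute_degree!
  have hf : f ≠ 0 := by
    intro h; rw [h] at hdeg; simp at hdeg
  have hsub : cubicRoots A B p ⊆ f.roots.toFinset := by
    intro x hx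
    simp only [cubicRoots, mem_filter, mem_univ, true_and] at hx
    rw [Multiset.mem_toFinset, Polynomial.mem_roots hf]
    simp only [f, Polynomial.IsRoot, Polynomial.eval_add, Polynomial.eval_pow, Polynomial.eval_X,
      Polynomial.eval_mul, Polynomial.eval_C]
    rw [← add_assoc]; exact hx
  calc #(cubicRoots A B p) ≤ #f.roots.toFinset := card_le_card hsub
    _ ≤ Multiset.card f.roots := Multiset.toFinset_card_le _
    _ ≤ f.natDegree := Polynomial.card_roots' _
    _ = 3 := hdeg

lemma div_mem_cubicRoots {A B : ℤ} {p : ℕ} [Fact p.Prime] {u z : ℤ} (hz : ¬ (p : ℤ) ∣ z)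
    (h : (p : ℤ) ∣ F A B u z) : (u : ZMod p) / (z : ZMod p) ∈ cubicRoots A B p := by
  have hz0 : (z : ZMod p) ≠ 0 := by rwa [Ne, ZMod.intCast_zmod_eq_zero_iff_dvd]
  have h0 : ((F A B u z : ℤ) : ZMod p) = 0 := by rwa [ZMod.intCast_zmod_eq_zero_iff_dvd]
  simp only [F, Int.cast_id] at h0
  push_cast at h0
  simp only [cubicRoots, mem_filter, mem_univ, true_and]
  field_simp
  linear_combination h0

lemma dvd_det_of_div_eq {p : ℕ} [Fact p.Prime] {u z u' z' : ℤ} (hz : ¬ (p : ℤ) ∣ z)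
    (hz' : ¬ (p : ℤ) ∣ z')
    (h : (u : ZMod p) / (z : ZMod p) = (u' : ZMod p) / (z' : ZMod p)) :
    (p : ℤ) ∣ u * z' - u' * z := by
  have hz0 : (z : ZMod p) ≠ 0 := by rwa [Ne, ZMod.intCast_zmod_eq_zero_iff_dvd]
  have hz0' : (z' : ZMod p) ≠ 0 := by rwa [Ne, ZMod.intCast_zmod_eq_zero_iff_dvd]
  rw [div_eq_div_iff hz0 hz0'] at h
  rw [← ZMod.intCast_zmod_eq_zero_iff_dvd]
  push_cast
  rw [h, sub_self]

/-! ### Counting lemmas -/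

lemma card_le_of_fiberwise_le {α β : Type*} [DecidableEq β] {s : Finset α} {t : Finset β}
    {f : α → β} {c : ℝ} (hf : ∀ a ∈ s, f a ∈ t)
    (h : ∀ b ∈ t, (#(s.filter fun a => f a = b) : ℝ) ≤ c) : (#s : ℝ) ≤ #t * c := by
  rw [card_eq_sum_card_fiberwise hf, Nat.cast_sum]
  simpa using sum_le_sum h

/-- Integers of an interval of length `L` that are congruent to each other modulo `q`. -/
lemma card_le_of_pairwise_modEq {S : Finset ℕ} {n L q : ℕ}
    (hS : S ⊆ Ico n (n + L)) (h : ∀ x ∈ S, ∀ y ∈ S, (q : ℤ) ∣ (x : ℤ) - y) :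
    (#S : ℝ) ≤ L / q + 1 := by
  have hcard : #S ≤ #(range (L / q + 1)) := by
    refine card_le_card_of_injOn (fun x => (x - n) / q) (fun x hx => ?_) (fun x hx y hy hxy => ?_)
    · have := mem_Ico.1 (hS hx)
      simp only [coe_range, Set.mem_Iio, Nat.lt_succ_iff]
      exact Nat.div_le_div_right (by omega)
    · have hx' := mem_Ico.1 (hS hx)
      have hy' := mem_Ico.1 (hS hy)
      have hd := h x hx y hy
      simp only at hxy
      have hmod : (x - n) % q = (y - n) % q := by
        refine ((Nat.modEq_iff_dvd).2 ?_).symm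
        rw [Nat.cast_sub hx'.1, Nat.cast_sub hy'.1]
        simpa using hd
      have h1 := Nat.div_add_mod (x - n) q
      have h2 := Nat.div_add_mod (y - n) q
      rw [hxy, hmod] at h1
      omega
  rw [card_range] at hcard
  calc (#S : ℝ) ≤ ((L / q + 1 : ℕ) : ℝ) := by exact_mod_cast hcard
    _ ≤ L / q + 1 := by push_cast; gcongr; exact Nat.cast_div_le

lemma card_filter_dvd_le (n L : ℕ) {q M : ℕ} (c : ℤ) (hM : IsCoprime (q : ℤ) M) :
    (#((Ico n (n + L)).filter fun i : ℕ => (q : ℤ) ∣ c + M * i) : ℝ) ≤ L / q + 1 := by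
  refine card_le_of_pairwise_modEq (filter_subset _ _) fun x hx y hy => ?_
  have h := dvd_sub (mem_filter.1 hx).2 (mem_filter.1 hy).2
  refine hM.dvd_of_dvd_mul_left (?_ : (q : ℤ) ∣ M * ((x : ℤ) - y))
  rwa [show (M : ℤ) * ((x : ℤ) - y) = c + M * x - (c + M * y) by ring]

/-- Primitive points of a box whose pairwise determinants are divisible by `q`. -/
lemma card_le_of_pairwise_dvd_det {S : Finset (ℕ × ℕ)} {q Umax Vmin Vmax : ℕ} (hq : 0 < q)
    (hV : 0 < Vmin)
    (hbox : ∀ t ∈ S, t.1 ≤ Umax ∧ Vmin ≤ t.2 ∧ t.2 ≤ Vmax ∧ Nat.Coprime t.1 t.2)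
    (h : ∀ t ∈ S, ∀ t' ∈ S, (q : ℤ) ∣ t.1 * t'.2 - t'.1 * t.2) :
    (#S : ℝ) ≤ Umax * Vmax ^ 2 / (Vmin * q) + 1 := by
  have hq' : (0 : ℝ) < q := by exact_mod_cast hq
  have hV' : (0 : ℝ) < Vmin := by exact_mod_cast hV
  -- The slope, scaled so that a nonzero determinant, being at least `q` in absolute value,
  -- separates the values by at least 1. A zero determinant forces equality of primitive points, so
  -- the integer part of `g` is injective.
  set g : ℕ × ℕ → ℝ := fun t => t.1 * Vmax ^ 2 / (t.2 * q) with hg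
  have hg0 : ∀ t, 0 ≤ g t := fun t => by positivity
  have hcard : #S ≤ #(range (⌊(Umax * Vmax ^ 2 / (Vmin * q) : ℝ)⌋₊ + 1)) := by
    refine card_le_card_of_injOn (fun t => ⌊g t⌋₊) (fun t ht => ?_) (fun t ht t' ht' htt => ?_)
    · obtain ⟨h1, h2, h3, -⟩ := hbox t ht
      simp only [coe_range, Set.mem_Iio, Nat.lt_succ_iff]
      apply Nat.floor_le_floor
      simp only [hg]
      gcongr
    · obtain ⟨h1, h2, h3, h4⟩ := hbox t ht
      obtain ⟨h1', h2', h3', h4'⟩ := hbox t' ht'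
      have hd := h t ht t' ht'
      have hv : 0 < t.2 := by omega
      have hv' : 0 < t'.2 := by omega
      by_cases h0 : (t.1 * t'.2 - t'.1 * t.2 : ℤ) = 0
      · have h5 : t.1 * t'.2 = t'.1 * t.2 := by
          have : (t.1 * t'.2 : ℤ) = t'.1 * t.2 := by linarith
          exact_mod_cast this
        have h6 : t.2 ∣ t'.2 := h4.symm.dvd_of_dvd_mul_left (h5 ▸ Dvd.intro_left _ rfl)
        have h7 : t'.2 ∣ t.2 := h4'.symm.dvd_of_dvd_mul_left (h5 ▸ Dvd.intro_left _ rfl)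
        have h8 := Nat.dvd_antisymm h6 h7
        rw [h8] at h5
        exact Prod.ext (Nat.eq_of_mul_eq_mul_right hv' h5) h8
      · exfalso
        have h9 : (q : ℝ) ≤ |(t.1 * t'.2 - t'.1 * t.2 : ℝ)| := by
          have := Int.le_of_dvd (abs_pos.2 h0) ((dvd_abs _ _).2 hd)
          exact_mod_cast this
        have hvr : (0 : ℝ) < t.2 := by exact_mod_cast hv
        have hvr' : (0 : ℝ) < t'.2 := by exact_mod_cast hv'
        have hdiff : g t - g t' = (t.1 * t'.2 - t'.1 * t.2) * (Vmax ^ 2 / (t.2 * t'.2 * q)) := by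
          simp only [hg]; field_simp
        have habs : 1 ≤ |g t - g t'| := by
          rw [hdiff, abs_mul, abs_of_nonneg (by positivity : (0 : ℝ) ≤ Vmax ^ 2 / (t.2 * t'.2 * q))]
          have h3r : (t.2 : ℝ) ≤ Vmax := by exact_mod_cast h3
          have h3r' : (t'.2 : ℝ) ≤ Vmax := by exact_mod_cast h3'
          calc (1 : ℝ) = q * (t.2 * t'.2 / (t.2 * t'.2 * q)) := by field_simp
            _ ≤ _ := by
              gcongr
              nlinarith
        have e1 := Nat.floor_le (hg0 t)
        have e2 := Nat.floor_le (hg0 t')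
        have e3 := Nat.lt_floor_add_one (g t)
        have e4 := Nat.lt_floor_add_one (g t')
        simp only at htt
        rw [htt] at e1 e3
        rcases le_abs'.1 habs with h | h <;> linarith
  rw [card_range] at hcard
  calc (#S : ℝ) ≤ ((⌊(Umax * Vmax ^ 2 / (Vmin * q) : ℝ)⌋₊ + 1 : ℕ) : ℝ) := by exact_mod_cast hcard
    _ ≤ _ := by push_cast; gcongr; exact Nat.floor_le (by positivity)

lemma sum_inv_sq_le {y : ℕ} (hy : 0 < y) (z : ℕ) :
    ∑ n ∈ Ioc y z, (1 : ℝ) / n ^ 2 ≤ 1 / y := by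
  rcases le_total z y with h | h
  · rw [Ioc_eq_empty_of_le h]; simp
  · have hmain : ∑ n ∈ Ioc y z, (1 : ℝ) / n ^ 2 ≤ 1 / y - 1 / z := by
      induction z, h using Nat.le_induction with
      | base => simp
      | succ z hz ih =>
        rw [sum_Ioc_succ_top (by omega)]
        have hz0 : (0 : ℝ) < z := by exact_mod_cast lt_of_lt_of_le hy hz
        have : (1 : ℝ) / ((z + 1 : ℕ) : ℝ) ^ 2 ≤ 1 / z - 1 / ((z + 1 : ℕ) : ℝ) := by
          push_cast
          rw [div_sub_div _ _ (by positivity) (by positivity), div_le_div_iff₀ (by positivity)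
            (by positivity)]
          nlinarith
        linarith
    have : (0 : ℝ) ≤ 1 / z := by positivity
    linarith

/-- Cruder than a logarithm, but a square-root loss is affordable in `error_terms_le`. -/
lemma sum_inv_le_two_mul_sqrt (z : ℕ) : ∑ n ∈ Ioc 0 z, (1 : ℝ) / n ≤ 2 * √z := by
  induction z with
  | zero => simp
  | succ z ih =>
    rw [sum_Ioc_succ_top (by omega)]
    have h1 : (1 : ℝ) / ((z + 1 : ℕ) : ℝ) ≤ 2 * √((z + 1 : ℕ) : ℝ) - 2 * √z := by
      set s := √((z + 1 : ℕ) : ℝ) with hs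
      set t := √(z : ℝ) with ht
      have hs2 : s ^ 2 = ((z + 1 : ℕ) : ℝ) := Real.sq_sqrt (by positivity)
      have ht2 : t ^ 2 = z := Real.sq_sqrt (by positivity)
      have ht0 : 0 ≤ t := Real.sqrt_nonneg _
      have hs1 : 1 ≤ s := by
        rw [hs, Real.one_le_sqrt]; push_cast; linarith [Nat.cast_nonneg (α := ℝ) z]
      have hts : t ≤ s := Real.sqrt_le_sqrt (by push_cast; linarith)
      rw [← hs2, div_le_iff₀ (by positivity)]
      have h3 : (s - t) * (s + t) = 1 := by push_cast at hs2; nlinarith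
      nlinarith [mul_nonneg (sub_nonneg.2 hts) (sub_nonneg.2 hts),
        mul_nonneg (mul_nonneg (sub_nonneg.2 hts) (sub_nonneg.2 hs1)) (by linarith : 0 ≤ s)]
    linarith

/-! ### Triples in arithmetic progressions -/

/-- The `i`-th term of the arithmetic progression `c mod M`. -/
def term (M c i : ℕ) : ℤ := c + M * i

/-- The indices of the triples that are counted. -/
def box (I J K : ℕ) : Finset (ℕ × ℕ × ℕ) := Ico I (I + I) ×ˢ Ico J (J + J) ×ˢ Ico 1 (1 + K)

lemma mem_box {I J K : ℕ} {t : ℕ × ℕ × ℕ} : t ∈ box I J K ↔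
    (I ≤ t.1 ∧ t.1 < I + I) ∧ (J ≤ t.2.1 ∧ t.2.1 < J + J) ∧ 1 ≤ t.2.2 ∧ t.2.2 < 1 + K := by
  simp only [box, mem_product, mem_Ico]

lemma card_box (I J K : ℕ) : #(box I J K) = I * (J * K) := by
  simp [box, card_product]

lemma le_term {M c i I : ℕ} (h : I ≤ i) : (M : ℤ) * I ≤ term M c i := by
  simp only [term]; norm_cast; nlinarith

lemma term_le {M c i I : ℕ} (hc : c ≤ M) (h : i < I + I) (hI : 0 < I) :
    term M c i ≤ 3 * M * I := by
  simp only [term]; norm_cast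
  have : i + 1 ≤ I + I := h
  nlinarith [Nat.mul_le_mul_left M this, Nat.mul_le_mul_left M hI]

lemma term_injective {M : ℕ} (hM : 0 < M) (c : ℕ) : Function.Injective (term M c) := by
  intro i j h
  simpa [term, hM.ne'] using h

lemma card_filter_dvd_term_le (n L : ℕ) {q M : ℕ} (c : ℕ) (hM : Nat.Coprime q M) :
    (#((Ico n (n + L)).filter fun i => (q : ℤ) ∣ term M c i) : ℝ) ≤ L / q + 1 :=
  card_filter_dvd_le n L c (Nat.isCoprime_iff_coprime.2 hM)

/-! ### Counting the bad triples for a single prime -/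

section Bad

variable (A B : ℤ) (M a I J K p : ℕ)

/-- Triples with `p ^ 2 ∣ v`. -/
def badSqV : Finset (ℕ × ℕ × ℕ) :=
  (box I J K).filter fun t => ((p ^ 2 : ℕ) : ℤ) ∣ term M a t.2.1

/-- Triples with `p ∣ u` and `p ∣ v`. -/
def badUV : Finset (ℕ × ℕ × ℕ) :=
  (box I J K).filter fun t => (p : ℤ) ∣ term M 1 t.1 ∧ (p : ℤ) ∣ term M a t.2.1

/-- Triples with `p ∣ u` and `p ∣ w`. -/
def badUW : Finset (ℕ × ℕ × ℕ) :=
  (box I J K).filter fun t => (p : ℤ) ∣ term M 1 t.1 ∧ (p : ℤ) ∣ term M 0 t.2.2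

open scoped Classical in
/-- Triples with `u`, `v` coprime, `p ∤ v w ^ 2` and `p ^ 2 ∣ F(u, v w ^ 2)`. -/
def badF : Finset (ℕ × ℕ × ℕ) :=
  (box I J K).filter fun t => IsCoprime (term M 1 t.1) (term M a t.2.1) ∧
    ¬ (p : ℤ) ∣ term M a t.2.1 * term M 0 t.2.2 ^ 2 ∧
    (p : ℤ) ^ 2 ∣ F A B (term M 1 t.1) (term M a t.2.1 * term M 0 t.2.2 ^ 2)

variable {A B M a I J K p}

lemma card_badSqV_le (hM : Nat.Coprime p M) :
    (#(badSqV M a I J K p) : ℝ) ≤ I * K * (J / (p : ℝ) ^ 2 + 1) := by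
  have hsub : badSqV M a I J K p ⊆ Ico I (I + I) ×ˢ
      ((Ico J (J + J)).filter fun j => ((p ^ 2 : ℕ) : ℤ) ∣ term M a j) ×ˢ Ico 1 (1 + K) := by
    intro t ht
    simp only [badSqV, box, mem_filter, mem_product] at ht ⊢
    tauto
  have h1 := card_filter_dvd_term_le J J a (hM.pow_left 2)
  have h2 := card_le_card hsub
  simp only [card_product, Nat.card_Ico, Nat.add_sub_cancel_left] at h2
  calc (#(badSqV M a I J K p) : ℝ) ≤ I * ((#((Ico J (J + J)).filter
        fun j => ((p ^ 2 : ℕ) : ℤ) ∣ term M a j) : ℝ) * K) := by exact_mod_cast h2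
    _ ≤ I * ((J / (p ^ 2 : ℕ) + 1) * K) := by gcongr
    _ = _ := by push_cast; ring

lemma card_badUV_le (hM : Nat.Coprime p M) :
    (#(badUV M a I J K p) : ℝ) ≤ K * ((I / p + 1) * (J / p + 1)) := by
  have hsub : badUV M a I J K p ⊆ ((Ico I (I + I)).filter fun i => (p : ℤ) ∣ term M 1 i) ×ˢ
      ((Ico J (J + J)).filter fun j => (p : ℤ) ∣ term M a j) ×ˢ Ico 1 (1 + K) := by
    intro t ht
    simp only [badUV, box, mem_filter, mem_product] at ht ⊢
    tauto
  have h1 := card_filter_dvd_term_le I I 1 hM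
  have h2 := card_filter_dvd_term_le J J a hM
  have h3 := card_le_card hsub
  simp only [card_product, Nat.card_Ico, Nat.add_sub_cancel_left] at h3
  calc (#(badUV M a I J K p) : ℝ) ≤ (#((Ico I (I + I)).filter fun i => (p : ℤ) ∣ term M 1 i) : ℝ)
        * ((#((Ico J (J + J)).filter fun j => (p : ℤ) ∣ term M a j) : ℝ) * K) := by
        exact_mod_cast h3
    _ ≤ (I / p + 1) * ((J / p + 1) * K) := by gcongr
    _ = _ := by ring

lemma card_badUW_le (hM : Nat.Coprime p M) :
    (#(badUW M I J K p) : ℝ) ≤ J * ((I / p + 1) * (K / p + 1)) := by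
  have hsub : badUW M I J K p ⊆ ((Ico I (I + I)).filter fun i => (p : ℤ) ∣ term M 1 i) ×ˢ
      Ico J (J + J) ×ˢ ((Ico 1 (1 + K)).filter fun k => (p : ℤ) ∣ term M 0 k) := by
    intro t ht
    simp only [badUW, box, mem_filter, mem_product] at ht ⊢
    tauto
  have h1 := card_filter_dvd_term_le I I 1 hM
  have h2 := card_filter_dvd_term_le 1 K 0 hM
  have h3 := card_le_card hsub
  simp only [card_product, Nat.card_Ico, Nat.add_sub_cancel_left] at h3
  calc (#(badUW M I J K p) : ℝ) ≤ (#((Ico I (I + I)).filter fun i => (p : ℤ) ∣ term M 1 i) : ℝ)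
        * (J * (#((Ico 1 (1 + K)).filter fun k => (p : ℤ) ∣ term M 0 k) : ℝ)) := by
        exact_mod_cast h3
    _ ≤ (I / p + 1) * (J * (K / p + 1)) := by gcongr
    _ = _ := by ring

lemma mem_badF {t : ℕ × ℕ × ℕ} : t ∈ badF A B M a I J K p ↔ t ∈ box I J K ∧
    IsCoprime (term M 1 t.1) (term M a t.2.1) ∧
    ¬ (p : ℤ) ∣ term M a t.2.1 * term M 0 t.2.2 ^ 2 ∧
    (p : ℤ) ^ 2 ∣ F A B (term M 1 t.1) (term M a t.2.1 * term M 0 t.2.2 ^ 2) := by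
  simp only [badF, mem_filter]

/-- The residue of `u / (v w ^ 2)` modulo `p`. -/
def ratio (M a p : ℕ) [Fact p.Prime] (t : ℕ × ℕ × ℕ) : ZMod p :=
  (term M 1 t.1 : ZMod p) / ((term M a t.2.1 * term M 0 t.2.2 ^ 2 : ℤ) : ZMod p)

lemma ratio_mem [Fact p.Prime] {t : ℕ × ℕ × ℕ} (ht : t ∈ badF A B M a I J K p) :
    ratio M a p t ∈ cubicRoots A B p := by
  obtain ⟨-, -, h1, h2⟩ := mem_badF.1 ht
  exact div_mem_cubicRoots h1 ((dvd_pow_self _ two_ne_zero).trans h2)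

/-- Apply `sq_dvd_det_of_roots` to the points `(u, v w²)`; the common factor `w²` is prime to `p`
and cancels. -/
lemma sq_dvd_of_ratio_eq [Fact p.Prime] (hD : ¬ (p : ℤ) ∣ 4 * A ^ 3 + 27 * B ^ 2)
    {t t' : ℕ × ℕ × ℕ} (ht : t ∈ badF A B M a I J K p) (ht' : t' ∈ badF A B M a I J K p)
    (h : ratio M a p t = ratio M a p t') (hk : t.2.2 = t'.2.2) :
    ((p ^ 2 : ℕ) : ℤ) ∣ term M 1 t.1 * term M a t'.2.1 - term M 1 t'.1 * term M a t.2.1 := by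
  obtain ⟨-, -, h1, h2⟩ := mem_badF.1 ht
  obtain ⟨-, -, h1', h2'⟩ := mem_badF.1 ht'
  have hp : Prime (p : ℤ) := Nat.prime_iff_prime_int.1 Fact.out
  have h3 := sq_dvd_det_of_roots hp hD h1 h1' h2 h2' (dvd_det_of_div_eq h1 h1' h)
  rw [← hk] at h3
  have hw : ¬ (p : ℤ) ∣ term M 0 t.2.2 ^ 2 := fun h => h1 (h.mul_left _)
  push_cast
  refine hp.pow_dvd_of_dvd_mul_right 2 hw ?_
  exact h3.trans (dvd_of_eq (by ring))

/-- Once `v`, `w` and one of at most three roots modulo `p` are fixed, `u` lies in a single class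
modulo `p²`. -/
lemma card_badF_le_of_small (hp : p.Prime) (hM : Nat.Coprime p M)
    (hD : ¬ (p : ℤ) ∣ 4 * A ^ 3 + 27 * B ^ 2) :
    (#(badF A B M a I J K p) : ℝ) ≤ 3 * (J * K) * (I / (p : ℝ) ^ 2 + 1) := by
  have : Fact p.Prime := ⟨hp⟩
  have h := card_le_of_fiberwise_le (s := badF A B M a I J K p)
    (t := (Ico J (J + J) ×ˢ Ico 1 (1 + K)) ×ˢ cubicRoots A B p)
    (f := fun t => (t.2, ratio M a p t)) (c := I / (p : ℝ) ^ 2 + 1) ?_ ?_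
  · refine h.trans ?_
    simp only [card_product, Nat.card_Ico, Nat.add_sub_cancel_left]
    have h3 : (#(cubicRoots A B p) : ℝ) ≤ 3 := by exact_mod_cast card_cubicRoots_le A B p
    push_cast
    rw [mul_comm (3 : ℝ)]
    gcongr
  · intro t ht
    have := (mem_badF.1 ht).1
    simp only [box, mem_product] at this
    simp only [mem_product]
    exact ⟨this.2, ratio_mem ht⟩
  · intro b _
    set S := (badF A B M a I J K p).filter fun t => (t.2, ratio M a p t) = b with hS
    have hinj : Set.InjOn Prod.fst (S : Set (ℕ × ℕ × ℕ)) := by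
      intro t ht t' ht' htt
      have h1 := (mem_filter.1 (mem_coe.1 ht)).2
      have h2 := (mem_filter.1 (mem_coe.1 ht')).2
      exact Prod.ext htt (congrArg Prod.fst (h1.trans h2.symm))
    rw [← card_image_of_injOn hinj]
    have := card_le_of_pairwise_modEq (S := S.image Prod.fst) (n := I) (L := I) (q := p ^ 2) ?_ ?_
    · simpa using this
    · intro i hi
      obtain ⟨t, ht, rfl⟩ := mem_image.1 hi
      have := (mem_badF.1 (mem_filter.1 ht).1).1
      simp only [box, mem_product] at this
      exact this.1
    · intro x hx y hy
      obtain ⟨t, ht, rfl⟩ := mem_image.1 hx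
      obtain ⟨t', ht', rfl⟩ := mem_image.1 hy
      obtain ⟨h1, h2⟩ := mem_filter.1 ht
      obtain ⟨h1', h2'⟩ := mem_filter.1 ht'
      have h3 := Prod.ext_iff.1 (h2.trans h2'.symm)
      simp only at h3
      have h4 := sq_dvd_of_ratio_eq hD h1 h1' h3.2 (by rw [h3.1])
      rw [h3.1] at h4
      have hp' : Prime (p : ℤ) := Nat.prime_iff_prime_int.1 hp
      have hv : ¬ (p : ℤ) ∣ term M a t'.2.1 := fun h => (mem_badF.1 h1').2.2.1 (h.mul_right _)
      have hMp : ¬ (p : ℤ) ∣ M := by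
        rw [Int.natCast_dvd_natCast]; exact (Nat.Prime.coprime_iff_not_dvd hp).1 hM
      push_cast at h4 ⊢
      refine hp'.pow_dvd_of_dvd_mul_right 2 hMp (hp'.pow_dvd_of_dvd_mul_right 2 hv ?_)
      -- With equal `v` the determinant is `M v` times the difference of the indices of `u`.
      exact h4.trans (dvd_of_eq (by simp only [term]; ring))

/-- Fixing `v` would cost at least 1 for each pair `(v, w)`, too much for large `p`. Here only `w`
and the root are fixed, and the primitive points `(u, v)` are counted by their slopes. -/
lemma card_badF_le_of_large (hp : p.Prime) (hM0 : 0 < M) (ha : a ≤ M) (hI : 0 < I) (hJ : 0 < J)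
    (hD : ¬ (p : ℤ) ∣ 4 * A ^ 3 + 27 * B ^ 2) :
    (#(badF A B M a I J K p) : ℝ) ≤ 3 * K * (27 * M ^ 2 * I * J / (p : ℝ) ^ 2 + 1) := by
  have : Fact p.Prime := ⟨hp⟩
  have h := card_le_of_fiberwise_le (s := badF A B M a I J K p)
    (t := Ico 1 (1 + K) ×ˢ cubicRoots A B p)
    (f := fun t => (t.2.2, ratio M a p t)) (c := 27 * M ^ 2 * I * J / (p : ℝ) ^ 2 + 1) ?_ ?_
  · refine h.trans ?_
    simp only [card_product, Nat.card_Ico, Nat.add_sub_cancel_left]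
    have h3 : (#(cubicRoots A B p) : ℝ) ≤ 3 := by exact_mod_cast card_cubicRoots_le A B p
    push_cast
    rw [mul_comm (3 : ℝ)]
    gcongr
  · intro t ht
    have := (mem_badF.1 ht).1
    simp only [box, mem_product] at this
    simp only [mem_product]
    exact ⟨this.2.2, ratio_mem ht⟩
  · intro b _
    set S := (badF A B M a I J K p).filter fun t => (t.2.2, ratio M a p t) = b with hS
    set g : ℕ × ℕ × ℕ → ℕ × ℕ := fun t => (1 + M * t.1, a + M * t.2.1) with hg
    have hinj : Set.InjOn g (S : Set (ℕ × ℕ × ℕ)) := by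
      intro t ht t' ht' htt
      have h1 := (mem_filter.1 (mem_coe.1 ht)).2
      have h2 := (mem_filter.1 (mem_coe.1 ht')).2
      have h3 := congrArg Prod.fst (h1.trans h2.symm)
      simp only [hg, Prod.mk.injEq, add_right_inj, mul_eq_mul_left_iff, hM0.ne', or_false] at htt
      exact Prod.ext htt.1 (Prod.ext htt.2 h3)
    rw [← card_image_of_injOn hinj]
    -- The 27 comes from `Umax * Vmax² / Vmin = 27 M² I J`.
    have := card_le_of_pairwise_dvd_det (S := S.image g) (q := p ^ 2) (Umax := 3 * M * I)
      (Vmin := M * J) (Vmax := 3 * M * J) (pow_pos hp.pos 2) (Nat.mul_pos hM0 hJ) ?_ ?_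
    · refine this.trans_eq ?_
      have hM' : (M : ℝ) ≠ 0 := by exact_mod_cast hM0.ne'
      have hJ' : (J : ℝ) ≠ 0 := by exact_mod_cast hJ.ne'
      have hp' : (p : ℝ) ≠ 0 := by exact_mod_cast hp.ne_zero
      push_cast
      field_simp
      ring
    · intro x hx
      obtain ⟨t, ht, rfl⟩ := mem_image.1 hx
      obtain ⟨hb, hc, -⟩ := mem_badF.1 (mem_filter.1 ht).1
      obtain ⟨hb1, hb2, -⟩ := mem_box.1 hb
      have e1 := term_le (M := M) (c := 1) hM0 hb1.2 hI
      have e2 := le_term (M := M) (c := a) hb2.1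
      have e3 := term_le (M := M) (c := a) ha hb2.2 hJ
      simp only [term] at e1 e2 e3 hc
      refine ⟨by exact_mod_cast e1, by exact_mod_cast e2, by exact_mod_cast e3, ?_⟩
      rw [← Nat.isCoprime_iff_coprime]
      exact_mod_cast hc
    · intro x hx y hy
      obtain ⟨t, ht, rfl⟩ := mem_image.1 hx
      obtain ⟨t', ht', rfl⟩ := mem_image.1 hy
      obtain ⟨h1, h2⟩ := mem_filter.1 ht
      obtain ⟨h1', h2'⟩ := mem_filter.1 ht'
      have h3 := Prod.ext_iff.1 (h2.trans h2'.symm)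
      simp only at h3
      have h4 := sq_dvd_of_ratio_eq hD h1 h1' h3.2 h3.1
      simp only [term] at h4
      simpa only [hg, Nat.cast_add, Nat.cast_mul] using h4

end Bad

/-! ### Size of the cubic form -/

/-- As `z ≤ u`, the two lower terms are at most `(|A| + |B|) u² z`, which the choice of `L` makes at
most `u³ / 2`. -/
lemma F_bounds {A B L u z : ℤ} (hL : L = 2 * (|A| + |B| + 1)) (hz : 0 ≤ z) (h : L * z ≤ u) :
    u ^ 3 ≤ 2 * F A B u z ∧ F A B u z ≤ 2 * u ^ 3 := by
  have hA := abs_nonneg A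
  have hB := abs_nonneg B
  have hzu : z ≤ u := by nlinarith
  have hu : 0 ≤ u := hz.trans hzu
  have h1 : |A * u * z ^ 2| ≤ |A| * (u ^ 2 * z) := by
    rw [abs_mul, abs_mul, abs_of_nonneg hu, abs_of_nonneg (by positivity : 0 ≤ z ^ 2), mul_assoc]
    refine mul_le_mul_of_nonneg_left ?_ hA
    nlinarith [mul_nonneg (mul_nonneg hu hz) (sub_nonneg.2 hzu)]
  have h2 : |B * z ^ 3| ≤ |B| * (u ^ 2 * z) := by
    rw [abs_mul, abs_of_nonneg (by positivity : 0 ≤ z ^ 3)]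
    gcongr
    have : z ^ 2 ≤ u ^ 2 := by gcongr
    nlinarith [mul_nonneg hz (sub_nonneg.2 this)]
  have h3 : 2 * ((|A| + |B|) * (u ^ 2 * z)) ≤ u ^ 3 := by
    have : u ^ 2 * (L * z) ≤ u ^ 2 * u := by gcongr
    have h0 : 0 ≤ u ^ 2 * z := by positivity
    subst hL
    nlinarith
  have h4 := abs_le.1 h1
  have h5 := abs_le.1 h2
  have h6 : F A B u z = u ^ 3 + A * u * z ^ 2 + B * z ^ 3 := by simp only [F, Int.cast_id]
  have h7 : (0 : ℤ) ≤ u ^ 3 := by positivity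
  constructor <;> nlinarith

/-! ### Square-free values in a box -/

lemma sum_Ioc_le {y : ℕ} (hy : 0 < y) (z : ℕ) {a b c : ℝ} (ha : 0 ≤ a) (hb : 0 ≤ b)
    (hc : 0 ≤ c) :
    ∑ n ∈ Ioc y z, (a / (n : ℝ) ^ 2 + b / n + c) ≤ a / y + 2 * b * √z + c * z := by
  have h1 := mul_le_mul_of_nonneg_left (sum_inv_sq_le hy z) ha
  have h2 : ∑ n ∈ Ioc y z, (1 : ℝ) / n ≤ 2 * √z :=
    (sum_le_sum_of_subset_of_nonneg (Ioc_subset_Ioc_left (Nat.zero_le y))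
      fun _ _ _ => by positivity).trans (sum_inv_le_two_mul_sqrt z)
  have h3 := mul_le_mul_of_nonneg_left h2 hb
  have h4 : ((z - y : ℕ) : ℝ) ≤ z := by exact_mod_cast Nat.sub_le z y
  have h5 := mul_le_mul_of_nonneg_left h4 hc
  rw [mul_sum] at h1 h3
  simp only [mul_one_div] at h1 h3
  rw [sum_add_distrib, sum_add_distrib, sum_const, Nat.card_Ioc, nsmul_eq_mul]
  linarith

-- A union bound in which the sum over primes is enlarged to all integers of the interval; the
-- `1/n²` part still gains `1/y`.
open scoped Classical in
lemma card_biUnion_le_of_bound {y : ℕ} (hy : 0 < y) (z : ℕ) {a b c : ℝ} (ha : 0 ≤ a)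
    (hb : 0 ≤ b) (hc : 0 ≤ c) (P : ℕ → Prop) (S : ℕ → Finset (ℕ × ℕ × ℕ))
    (h : ∀ p ∈ Ioc y z, P p → (#(S p) : ℝ) ≤ a / (p : ℝ) ^ 2 + b / p + c) :
    (#(((Ioc y z).filter P).biUnion S) : ℝ) ≤ a / y + 2 * b * √z + c * z := by
  refine le_trans ?_ (sum_Ioc_le hy z ha hb hc)
  calc (#(((Ioc y z).filter P).biUnion S) : ℝ) ≤ ∑ p ∈ (Ioc y z).filter P, (#(S p) : ℝ) := by
        exact_mod_cast card_biUnion_le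
    _ ≤ ∑ p ∈ (Ioc y z).filter P, (a / (p : ℝ) ^ 2 + b / p + c) :=
        sum_le_sum fun p hp => h p (mem_filter.1 hp).1 (mem_filter.1 hp).2
    _ ≤ _ := sum_le_sum_of_subset_of_nonneg (filter_subset _ _) fun _ _ _ => by positivity

/-- The value of `Q` at the triple with indices `t`. -/
def valQ (A B : ℤ) (M a : ℕ) (t : ℕ × ℕ × ℕ) : ℤ :=
  Q A B (term M 1 t.1) (term M a t.2.1) (term M 0 t.2.2)

lemma valQ_eq (A B : ℤ) (M a : ℕ) (t : ℕ × ℕ × ℕ) : valQ A B M a t =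
    term M a t.2.1 * F A B (term M 1 t.1) (term M a t.2.1 * term M 0 t.2.2 ^ 2) := rfl

/-- Modulo `M`, `w` vanishes and `u` is 1, so `F` is 1 and `Q` reduces to `v`. -/
lemma valQ_modEq (A B : ℤ) (M a : ℕ) (t : ℕ × ℕ × ℕ) : (M : ℤ) ∣ valQ A B M a t - a := by
  rw [← ZMod.intCast_zmod_eq_zero_iff_dvd]
  simp [valQ, Q, F, term]

/-- The constant that controls the ratio `u / (v w ^ 2)`. -/
def domConst (A B : ℤ) : ℤ := 2 * (|A| + |B| + 1)

lemma domConst_ge (A B : ℤ) : 2 ≤ domConst A B := by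
  have := abs_nonneg A; have := abs_nonneg B; simp only [domConst]; linarith

/-! ### Covering the non-square-free values by bad triples -/

section Box

variable {A B : ℤ} {M a I J K : ℕ} {t : ℕ × ℕ × ℕ}

lemma dom_of_mem_box (hM : 0 < M) (ha : a ≤ M) (hJ : 0 < J)
    (hdom : 3 * domConst A B * M ^ 2 * J * K ^ 2 ≤ I) (ht : t ∈ box I J K) :
    domConst A B * (term M a t.2.1 * term M 0 t.2.2 ^ 2) ≤ term M 1 t.1 := by
  obtain ⟨⟨h1, -⟩, ⟨h2, h3⟩, h4, h5⟩ := mem_box.1 ht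
  have e1 := le_term (M := M) (c := 1) h1
  have e2 := term_le ha h3 hJ
  have e3 : term M 0 t.2.2 = M * t.2.2 := by simp [term]
  have h6 : (t.2.2 : ℤ) ≤ K := by exact_mod_cast (by omega : t.2.2 ≤ K)
  have hL := domConst_ge A B
  have hM' : (0 : ℤ) < M := by exact_mod_cast hM
  calc domConst A B * (term M a t.2.1 * term M 0 t.2.2 ^ 2)
      ≤ domConst A B * ((3 * M * J) * (M * K) ^ 2) := by rw [e3]; gcongr
    _ = M * (3 * domConst A B * M ^ 2 * J * K ^ 2) := by ring
    _ ≤ M * I := by gcongr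
    _ ≤ _ := e1

lemma term_pos_of_mem_box (hM : 0 < M) (hJ : 0 < J) (ht : t ∈ box I J K) :
    1 ≤ term M 1 t.1 ∧ 1 ≤ term M a t.2.1 ∧ 1 ≤ term M 0 t.2.2 := by
  obtain ⟨⟨h1, -⟩, ⟨h2, h3⟩, h4, h5⟩ := mem_box.1 ht
  simp only [term]
  norm_cast
  have e1 := Nat.mul_le_mul hM h1
  have e2 := Nat.mul_le_mul hM h2
  have e3 := Nat.mul_le_mul hM h4
  simp only [mul_one] at e1 e2 e3
  exact ⟨by omega, by omega, by omega⟩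

lemma F_bounds_of_mem_box (hM : 0 < M) (ha : a ≤ M) (hJ : 0 < J)
    (hdom : 3 * domConst A B * M ^ 2 * J * K ^ 2 ≤ I) (ht : t ∈ box I J K) :
    term M 1 t.1 ^ 3 ≤ 2 * F A B (term M 1 t.1) (term M a t.2.1 * term M 0 t.2.2 ^ 2) ∧
    F A B (term M 1 t.1) (term M a t.2.1 * term M 0 t.2.2 ^ 2) ≤ 2 * term M 1 t.1 ^ 3 := by
  obtain ⟨h1, h2, h3⟩ := term_pos_of_mem_box (a := a) hM hJ ht
  exact F_bounds rfl (by positivity) (dom_of_mem_box hM ha hJ hdom ht)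

lemma F_pos_of_mem_box (hM : 0 < M) (ha : a ≤ M) (hJ : 0 < J)
    (hdom : 3 * domConst A B * M ^ 2 * J * K ^ 2 ≤ I) (ht : t ∈ box I J K) :
    0 < F A B (term M 1 t.1) (term M a t.2.1 * term M 0 t.2.2 ^ 2) := by
  obtain ⟨h1, -⟩ := term_pos_of_mem_box (a := a) hM hJ ht
  have := (F_bounds_of_mem_box hM ha hJ hdom ht).1
  have : 0 < term M 1 t.1 ^ 3 := by positivity
  linarith

open scoped Classical in
/-- The triples at which `Q` is not square-free. -/
noncomputable def notSqfree (A B : ℤ) (M a I J K : ℕ) : Finset (ℕ × ℕ × ℕ) :=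
  (box I J K).filter fun t => ¬ Squarefree (valQ A B M a t)

/-- The primes that do not divide the modulus. -/
def Unramified (M p : ℕ) : Prop := p.Prime ∧ Nat.Coprime p M

lemma Unramified.not_dvd {M p : ℕ} (h : Unramified M p) : ¬ (p : ℤ) ∣ M := by
  rw [Int.natCast_dvd_natCast]
  exact (Nat.Prime.coprime_iff_not_dvd h.1).1 h.2

-- A prime whose square divides `Q` is prime to `M`, because `Q ≡ a`, and so exceeds 12, because
-- `12! ∣ M`. The five families then correspond to how `p²` is shared between `v` and `F`, the last
-- case being cut at `√I`.
open scoped Classical in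
lemma notSqfree_subset (hM : 0 < M) (ha : a ≤ M) (haM : Nat.Coprime a M) (hI : 0 < I) (hJ : 0 < J)
    (hsmall : Nat.factorial 12 ∣ M)
    (hdom : 3 * domConst A B * M ^ 2 * J * K ^ 2 ≤ I) :
    notSqfree A B M a I J K ⊆
      ((Ioc 12 (Nat.sqrt (3 * M * J))).filter (Unramified M)).biUnion (badSqV M a I J K) ∪
      ((Ioc 12 (3 * M * J)).filter (Unramified M)).biUnion (badUV M a I J K) ∪
      ((Ioc 12 K).filter (Unramified M)).biUnion (badUW M I J K) ∪
      ((Ioc 12 (Nat.sqrt I)).filter (Unramified M)).biUnion (badF A B M a I J K) ∪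
      ((Ioc (Nat.sqrt I) (Nat.sqrt (54 * M ^ 3 * I ^ 3))).filter (Unramified M)).biUnion
        (badF A B M a I J K) := by
  intro t ht
  obtain ⟨hbox, hsq⟩ := mem_filter.1 ht
  obtain ⟨⟨h1, h1'⟩, ⟨h2, h2'⟩, h3, h3'⟩ := mem_box.1 hbox
  obtain ⟨hu, hv, hw⟩ := term_pos_of_mem_box (a := a) hM hJ hbox
  have hu3 := term_le (c := 1) hM h1' hI
  have hv3 := term_le ha h2' hJ
  obtain ⟨p, hp, hpQ⟩ : ∃ p : ℕ, p.Prime ∧ (p : ℤ) ^ 2 ∣ valQ A B M a t := by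
    rw [← Int.squarefree_natAbs, Nat.squarefree_iff_prime_squarefree] at hsq
    push Not at hsq
    obtain ⟨p, hp, h⟩ := hsq
    refine ⟨p, hp, ?_⟩
    rw [← Int.natCast_dvd] at h
    rw [pow_two]; exact_mod_cast h
  have hp' : Prime (p : ℤ) := Nat.prime_iff_prime_int.1 hp
  have hpM : Nat.Coprime p M := by
    rw [Nat.Prime.coprime_iff_not_dvd hp]
    intro hpM
    have h4 : (p : ℤ) ∣ valQ A B M a t := (dvd_pow_self _ two_ne_zero).trans hpQ
    have h5 : (p : ℤ) ∣ valQ A B M a t - a :=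
      (Int.natCast_dvd_natCast.2 hpM).trans (valQ_modEq A B M a t)
    have h6 : (p : ℤ) ∣ a := by simpa using dvd_sub h4 h5
    exact hp.one_lt.ne' (Nat.eq_one_of_dvd_coprimes haM (Int.natCast_dvd_natCast.1 h6) hpM)
  have hun : Unramified M p := ⟨hp, hpM⟩
  have hp12 : 12 < p := by
    by_contra hle
    exact (Nat.Prime.coprime_iff_not_dvd hp).1 hpM
      ((Nat.dvd_factorial hp.pos (by omega)).trans hsmall)
  have le_of_dvd : ∀ {q n : ℕ} {x : ℤ}, (q : ℤ) ∣ x → 1 ≤ x → x ≤ n → q ≤ n := fun h h0 hn => by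
    exact_mod_cast (Int.le_of_dvd (by linarith) h).trans hn
  simp only [mem_union, mem_biUnion, mem_filter, mem_Ioc]
  -- `F(u, z) ≡ u³` modulo `z`.
  have hpu_of : (p : ℤ) ∣ term M a t.2.1 * term M 0 t.2.2 ^ 2 →
      (p : ℤ) ∣ F A B (term M 1 t.1) (term M a t.2.1 * term M 0 t.2.2 ^ 2) →
      (p : ℤ) ∣ term M 1 t.1 := by
    intro hz hF
    refine hp'.dvd_of_dvd_pow (n := 3) ?_
    set z := term M a t.2.1 * term M 0 t.2.2 ^ 2
    have : term M 1 t.1 ^ 3 = F A B (term M 1 t.1) z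
        - z * (A * term M 1 t.1 * z + B * z ^ 2) := by
      simp only [F, Int.cast_id]; ring
    rw [this]
    exact dvd_sub hF (hz.mul_right _)
  have hUV : ∀ q : ℕ, q.Prime → (q : ℤ) ∣ term M 1 t.1 → (q : ℤ) ∣ term M a t.2.1 →
      ∃ p, ((12 < p ∧ p ≤ 3 * M * J) ∧ Unramified M p) ∧ t ∈ badUV M a I J K p := by
    intro q hq hqu hqv
    have hqM : Nat.Coprime q M := by
      rw [Nat.Prime.coprime_iff_not_dvd hq]
      intro hqM
      have h6 : (q : ℤ) ∣ 1 := by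
        have := dvd_sub hqu ((Int.natCast_dvd_natCast.2 hqM).mul_right (t.1 : ℤ))
        simpa [term] using this
      exact (Nat.prime_iff_prime_int.1 hq).not_dvd_one h6
    refine ⟨q, ⟨⟨?_, le_of_dvd hqv hv (by exact_mod_cast hv3)⟩, hq, hqM⟩,
      mem_filter.2 ⟨hbox, hqu, hqv⟩⟩
    by_contra hle
    exact (Nat.Prime.coprime_iff_not_dvd hq).1 hqM
      ((Nat.dvd_factorial hq.pos (by omega)).trans hsmall)
  rw [valQ_eq] at hpQ
  by_cases hpv : (p : ℤ) ∣ term M a t.2.1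
  · by_cases hpF : (p : ℤ) ∣ F A B (term M 1 t.1) (term M a t.2.1 * term M 0 t.2.2 ^ 2)
    · exact Or.inl (Or.inl (Or.inl (Or.inr (hUV p hp (hpu_of (hpv.mul_right _) hpF) hpv))))
    · have hpv2 : ((p ^ 2 : ℕ) : ℤ) ∣ term M a t.2.1 := by
        push_cast; exact hp'.pow_dvd_of_dvd_mul_right 2 hpF hpQ
      refine Or.inl (Or.inl (Or.inl (Or.inl ⟨p, ⟨⟨hp12, ?_⟩, hun⟩, mem_filter.2 ⟨hbox, hpv2⟩⟩)))
      rw [Nat.le_sqrt']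
      exact le_of_dvd hpv2 hv (by exact_mod_cast hv3)
  · have hpF : (p : ℤ) ^ 2 ∣ F A B (term M 1 t.1) (term M a t.2.1 * term M 0 t.2.2 ^ 2) :=
      hp'.pow_dvd_of_dvd_mul_left 2 hpv hpQ
    by_cases hpw : (p : ℤ) ∣ term M 0 t.2.2
    · have hpu := hpu_of (Dvd.dvd.mul_left (dvd_pow hpw two_ne_zero) _)
        ((dvd_pow_self _ two_ne_zero).trans hpF)
      refine Or.inl (Or.inl (Or.inr ⟨p, ⟨⟨hp12, ?_⟩, hun⟩, mem_filter.2 ⟨hbox, hpu, hpw⟩⟩))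
      have : (p : ℤ) ∣ t.2.2 := by
        simp only [term, Nat.cast_zero, zero_add] at hpw
        exact (hp'.dvd_or_dvd hpw).resolve_left hun.not_dvd
      exact (Nat.le_of_dvd (by omega) (Int.natCast_dvd_natCast.1 this)).trans (by omega)
    · by_cases hco : IsCoprime (term M 1 t.1) (term M a t.2.1)
      · have hbad : t ∈ badF A B M a I J K p := by
          refine mem_badF.2 ⟨hbox, hco, fun h => ?_, hpF⟩
          exact (hp'.dvd_or_dvd h).elim hpv fun h => hpw (hp'.dvd_of_dvd_pow h)
        by_cases hle : p ≤ Nat.sqrt I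
        · exact Or.inl (Or.inr ⟨p, ⟨⟨hp12, hle⟩, hun⟩, hbad⟩)
        · refine Or.inr ⟨p, ⟨⟨by omega, ?_⟩, hun⟩, hbad⟩
          rw [Nat.le_sqrt']
          have hpos := F_pos_of_mem_box hM ha hJ hdom hbox
          have hle2 := (F_bounds_of_mem_box hM ha hJ hdom hbox).2
          -- The range of `p` ends where `p² ≤ F ≤ 2 u³ ≤ 2 (3 M I)³ = 54 M³ I³`.
          have h7 : term M 1 t.1 ^ 3 ≤ (3 * M * I) ^ 3 := by gcongr
          refine le_of_dvd (by push_cast; exact hpF) hpos (hle2.trans ?_)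
          push_cast
          linarith
      -- If `u` and `v` are not coprime, a common prime `q`, possibly different from `p`, puts the
      -- triple in `badUV`.
      · rw [Int.isCoprime_iff_gcd_eq_one] at hco
        obtain ⟨q, hq, hqg⟩ := Nat.exists_prime_and_dvd hco
        have hqg' : (q : ℤ) ∣ (Int.gcd (term M 1 t.1) (term M a t.2.1) : ℤ) :=
          Int.natCast_dvd_natCast.2 hqg
        exact Or.inl (Or.inl (Or.inl (Or.inr (hUV q hq (hqg'.trans (Int.gcd_dvd_left _ _))
          (hqg'.trans (Int.gcd_dvd_right _ _))))))

end Box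

section Box

variable {A B : ℤ} {M a I J K : ℕ}

-- The cutoff 12 makes the main terms add up to `(1 + 1 + 1 + 3) / 12`, half of the box; everything
-- else is an error term.
open scoped Classical in
lemma card_notSqfree_le (hM : 0 < M) (ha : a ≤ M) (haM : Nat.Coprime a M) (hI : 0 < I)
    (hJ : 0 < J) (hsmall : Nat.factorial 12 ∣ M) (hD : 4 * A ^ 3 + 27 * B ^ 2 ∣ (M : ℤ))
    (hdom : 3 * domConst A B * M ^ 2 * J * K ^ 2 ≤ I) :
    (#(notSqfree A B M a I J K) : ℝ) ≤
      (I * K * J / 12 + I * K * √(3 * M * J)) +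
      (K * I * J / 12 + 2 * (K * (I + J)) * √(3 * M * J) + K * (3 * M * J)) +
      (J * I * K / 12 + 2 * (J * (I + K)) * √K + J * K) +
      (3 * (J * K) * I / 12 + 3 * (J * K) * √I) +
      (3 * K * (27 * M ^ 2 * I * J) / (Nat.sqrt I : ℕ) + 3 * K * √(54 * M ^ 3 * I ^ 3)) := by
  have hDp : ∀ p, Unramified M p → ¬ (p : ℤ) ∣ 4 * A ^ 3 + 27 * B ^ 2 :=
    fun p hp h => hp.not_dvd (h.trans hD)
  have hsqrt : ∀ n : ℕ, (Nat.sqrt n : ℝ) ≤ √(n : ℝ) := fun n => Real.nat_sqrt_le_real_sqrt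
  have h1 := card_biUnion_le_of_bound (y := 12) (by norm_num) (Nat.sqrt (3 * M * J))
    (a := I * K * J) (b := 0) (c := I * K) (by positivity) le_rfl (by positivity)
    (Unramified M) (badSqV M a I J K)
    (fun p _ hp => (card_badSqV_le hp.2).trans_eq (by ring))
  have h2 := card_biUnion_le_of_bound (y := 12) (by norm_num) (3 * M * J)
    (a := K * I * J) (b := K * (I + J)) (c := K) (by positivity) (by positivity) (by positivity)
    (Unramified M) (badUV M a I J K)
    (fun p _ hp => (card_badUV_le hp.2).trans_eq (by ring))
  have h3 := card_biUnion_le_of_bound (y := 12) (by norm_num) K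
    (a := J * I * K) (b := J * (I + K)) (c := J) (by positivity) (by positivity) (by positivity)
    (Unramified M) (badUW M I J K)
    (fun p _ hp => (card_badUW_le hp.2).trans_eq (by ring))
  have h4 := card_biUnion_le_of_bound (y := 12) (by norm_num) (Nat.sqrt I)
    (a := 3 * (J * K) * I) (b := 0) (c := 3 * (J * K)) (by positivity) le_rfl (by positivity)
    (Unramified M) (badF A B M a I J K)
    (fun p _ hp => (card_badF_le_of_small hp.1 hp.2 (hDp p hp)).trans_eq (by ring))
  have h5 := card_biUnion_le_of_bound (y := Nat.sqrt I) (Nat.sqrt_pos.2 hI)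
    (Nat.sqrt (54 * M ^ 3 * I ^ 3))
    (a := 3 * K * (27 * M ^ 2 * I * J)) (b := 0) (c := 3 * K) (by positivity) le_rfl
    (by positivity) (Unramified M) (badF A B M a I J K)
    (fun p _ hp => (card_badF_le_of_large hp.1 hM ha hI hJ (hDp p hp)).trans_eq (by ring))
  have e1 : (I * K : ℝ) * (Nat.sqrt (3 * M * J) : ℕ) ≤ I * K * √(3 * M * J) := by
    gcongr; exact_mod_cast hsqrt (3 * M * J)
  have e4 : 3 * (J * K : ℝ) * (Nat.sqrt I : ℕ) ≤ 3 * (J * K) * √I := by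
    gcongr; exact hsqrt I
  have e5 : 3 * (K : ℝ) * (Nat.sqrt (54 * M ^ 3 * I ^ 3) : ℕ) ≤ 3 * K * √(54 * M ^ 3 * I ^ 3) := by
    gcongr; exact_mod_cast hsqrt (54 * M ^ 3 * I ^ 3)
  have hsub := card_le_card (notSqfree_subset hM ha haM hI hJ hsmall hdom)
  have hun := hsub.trans ((card_union_le _ _).trans (Nat.add_le_add_right ((card_union_le _ _).trans
    (Nat.add_le_add_right ((card_union_le _ _).trans (Nat.add_le_add_right
    (card_union_le _ _) _)) _)) _))
  have hun' := (Nat.cast_le (α := ℝ)).2 hun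
  push_cast at hun' h1 h2 h3 h4 h5
  refine hun'.trans ?_
  simp only [mul_zero, zero_mul, add_zero] at h1 h2 h3 h4 h5
  gcongr
  · exact h1.trans (by linarith)
  · exact h4.trans (by linarith)
  · exact h5.trans (by linarith)

end Box

/-- The error terms of `card_notSqfree_le` are small for admissible boxes. -/
lemma error_terms_le (M : ℝ) (hM : 1 ≤ M) : ∃ T : ℝ, 1 ≤ T ∧ ∀ I J K y : ℝ,
    T ≤ I → T ≤ J → T ≤ K → T * I ≤ J ^ 2 → J ≤ I → K ≤ I → √I ≤ 2 * y →
    I * K * √(3 * M * J) + (2 * (K * (I + J)) * √(3 * M * J) + K * (3 * M * J)) +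
      (2 * (J * (I + K)) * √K + J * K) + 3 * (J * K) * √I +
      (3 * K * (27 * M ^ 2 * I * J) / y + 3 * K * √(54 * M ^ 3 * I ^ 3)) ≤ I * J * K / 4 := by
  set m := √(3 * M) with hm
  set n := √(54 * M ^ 3) with hn
  have hm0 : 0 ≤ m := Real.sqrt_nonneg _
  have hn0 : 0 ≤ n := Real.sqrt_nonneg _
  -- Every error term is a coefficient times a quantity at most `I J K / τ` or `2 I J K / τ`. `E`
  -- collects these coefficients, and `τ = 4 E` makes the total `I J K / 4`.
  set E := 5 * m + 3 * M + 8 + 162 * M ^ 2 + 3 * n with hE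
  have hE0 : 8 ≤ E := by
    have : 0 ≤ 162 * M ^ 2 := by positivity
    linarith
  have hτ : 1 ≤ 4 * E := by linarith
  refine ⟨(4 * E) ^ 2, one_le_pow₀ hτ, ?_⟩
  set τ := 4 * E with hτd
  intro I J K y hI hJ hK hskew hJI hKI hy
  have hτ0 : 0 < τ := by linarith
  have hI0 : 0 ≤ I := le_trans (by positivity) hI
  have hJ0 : 0 ≤ J := le_trans (by positivity) hJ
  have hK0 : 0 ≤ K := le_trans (by positivity) hK
  have hJpos : 0 < J := lt_of_lt_of_le (by positivity) hJ
  have hx : τ ≤ √I := Real.le_sqrt_of_sq_le hI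
  have hr : τ ≤ √J := Real.le_sqrt_of_sq_le hJ
  have hs : τ ≤ √K := Real.le_sqrt_of_sq_le hK
  -- Used only in `t7`, for the term `K I^(3/2)` left by the large primes.
  have hxJ : τ * √I ≤ J := by
    rw [← Real.sqrt_sq hJ0]
    refine Real.le_sqrt_of_sq_le ?_
    rw [mul_pow, Real.sq_sqrt hI0]; exact hskew
  have h1 : √(3 * M * J) = m * √J := Real.sqrt_mul (by positivity) _
  have h2 : √(54 * M ^ 3 * I ^ 3) = n * (I * √I) := by
    rw [Real.sqrt_mul (x := 54 * M ^ 3) (by positivity), show I ^ 3 = I ^ 2 * I by ring,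
      Real.sqrt_mul (x := I ^ 2) (by positivity), Real.sqrt_sq hI0]
  have hy0 : 0 < y := by linarith
  have gain : ∀ {x : ℝ}, 0 ≤ x → τ ≤ √x → τ * √x ≤ x := fun hx0 h =>
    (mul_le_mul_of_nonneg_right h (Real.sqrt_nonneg _)).trans_eq (Real.mul_self_sqrt hx0)
  have gI := gain hI0 hx
  have gJ := gain hJ0 hr
  have gK := gain hK0 hs
  have gy : τ ≤ 2 * y := hx.trans hy
  have gI1 : τ ≤ I := (le_self_pow₀ hτ two_ne_zero).trans hI
  have t1 : τ * (I * K * √J) ≤ I * J * K := by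
    calc τ * (I * K * √J) = I * K * (τ * √J) := by ring
      _ ≤ I * K * J := by gcongr
      _ = _ := by ring
  have t2 : τ * (K * (I + J) * √J) ≤ 2 * (I * J * K) := by
    calc τ * (K * (I + J) * √J) = K * (I + J) * (τ * √J) := by ring
      _ ≤ K * (I + I) * J := by gcongr
      _ = _ := by ring
  have t3 : τ * (K * J) ≤ I * J * K := by
    calc τ * (K * J) ≤ I * (K * J) := by gcongr
      _ = _ := by ring
  have t4 : τ * (J * (I + K) * √K) ≤ 2 * (I * J * K) := by
    calc τ * (J * (I + K) * √K) = J * (I + K) * (τ * √K) := by ring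
      _ ≤ J * (I + I) * K := by gcongr
      _ = _ := by ring
  have t5 : τ * (J * K * √I) ≤ I * J * K := by
    calc τ * (J * K * √I) = J * K * (τ * √I) := by ring
      _ ≤ J * K * I := by gcongr
      _ = _ := by ring
  have t6 : τ * (K * (I * J) / y) ≤ 2 * (I * J * K) := by
    rw [mul_div_assoc', div_le_iff₀ hy0]
    calc τ * (K * (I * J)) ≤ 2 * y * (K * (I * J)) := by gcongr
      _ = _ := by ring
  have t7 : τ * (K * (I * √I)) ≤ I * J * K := by
    calc τ * (K * (I * √I)) = K * I * (τ * √I) := by ring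
      _ ≤ K * I * J := by gcongr
      _ = _ := by ring
  rw [h1, h2]
  have key : τ * (I * K * (m * √J) + (2 * (K * (I + J)) * (m * √J) + K * (3 * M * J)) +
      (2 * (J * (I + K)) * √K + J * K) + 3 * (J * K) * √I +
      (3 * K * (27 * M ^ 2 * I * J) / y + 3 * K * (n * (I * √I)))) ≤ τ * (I * J * K / 4) := by
    have e6 : 3 * K * (27 * M ^ 2 * I * J) / y = 81 * M ^ 2 * (K * (I * J) / y) := by ring
    rw [e6]
    have s1 := mul_le_mul_of_nonneg_left t1 hm0
    have s2 := mul_le_mul_of_nonneg_left t2 (by positivity : 0 ≤ 2 * m)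
    have s3 := mul_le_mul_of_nonneg_left t3 (by positivity : 0 ≤ 3 * M)
    have s6 := mul_le_mul_of_nonneg_left t6 (by positivity : 0 ≤ 81 * M ^ 2)
    have s7 := mul_le_mul_of_nonneg_left t7 (by positivity : 0 ≤ 3 * n)
    have e : τ * (I * J * K / 4) = E * (I * J * K) := by rw [hτd]; ring
    rw [e, hE]
    linarith
  exact le_of_mul_le_mul_left key hτ0

open scoped Classical in
/-- The triples at which `Q` is square-free. -/
noncomputable def sqfreeTriples (A B : ℤ) (M a I J K : ℕ) : Finset (ℕ × ℕ × ℕ) :=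
  (box I J K).filter fun t => Squarefree (valQ A B M a t)

/-- At a positive proportion of the triples of an admissible box `Q` is square-free. -/
lemma exists_card_sqfreeTriples_ge (A B : ℤ) {M : ℕ} (hM : 0 < M)
    (hsmall : Nat.factorial 12 ∣ M) (hD : 4 * A ^ 3 + 27 * B ^ 2 ∣ (M : ℤ)) :
    ∃ T : ℝ, 1 ≤ T ∧ ∀ a I J K : ℕ, a ≤ M → Nat.Coprime a M →
      T ≤ I → T ≤ J → T ≤ K → T * I ≤ (J : ℝ) ^ 2 →
      3 * domConst A B * M ^ 2 * J * K ^ 2 ≤ I →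
      (I * J * K / 4 : ℝ) ≤ #(sqfreeTriples A B M a I J K) := by
  classical
  obtain ⟨T, hT1, hT⟩ := error_terms_le M (by exact_mod_cast hM)
  refine ⟨T, hT1, fun a I J K ha haM hI hJ hK hskew hdom => ?_⟩
  have pos : ∀ {n : ℕ}, T ≤ n → 0 < n := fun h => by
    have : (0 : ℝ) < _ := lt_of_lt_of_le (by linarith) h
    exact_mod_cast this
  have hI0 := pos hI
  have hJ0 := pos hJ
  have hK0 := pos hK
  have hL := domConst_ge A B
  have hC : (1 : ℤ) ≤ 3 * domConst A B * M ^ 2 := by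
    have : (1 : ℤ) ≤ (M : ℤ) ^ 2 := one_le_pow₀ (by exact_mod_cast hM)
    nlinarith
  have hJK : (J * K ^ 2 : ℤ) ≤ I := by
    refine le_trans ?_ hdom
    have : (0 : ℤ) ≤ J * K ^ 2 := by positivity
    nlinarith
  have hJK' : J * K ^ 2 ≤ I := by exact_mod_cast hJK
  have hJI : J ≤ I := le_trans (Nat.le_mul_of_pos_right _ (by positivity)) hJK'
  have hKI : K ≤ I := by
    refine le_trans ?_ hJK'
    calc K = 1 * K ^ 1 := by ring
      _ ≤ J * K ^ 2 := Nat.mul_le_mul hJ0 (Nat.pow_le_pow_right hK0 (by norm_num))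
  have hy : √(I : ℝ) ≤ 2 * (Nat.sqrt I : ℕ) := by
    have h1 := Real.real_sqrt_le_nat_sqrt_succ (a := I)
    have h2 : (1 : ℝ) ≤ (Nat.sqrt I : ℕ) := by exact_mod_cast Nat.sqrt_pos.2 hI0
    linarith
  have herr := hT I J K (Nat.sqrt I : ℕ) hI hJ hK hskew (by exact_mod_cast hJI)
    (by exact_mod_cast hKI) hy
  have hbad := card_notSqfree_le hM ha haM hI0 hJ0 hsmall hD hdom
  have hsplit : #(sqfreeTriples A B M a I J K) + #(notSqfree A B M a I J K) = I * (J * K) := by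
    rw [← card_box]
    exact card_filter_add_card_filter_not (s := box I J K) (fun t => Squarefree (valQ A B M a t))
  have hsplit' : (#(sqfreeTriples A B M a I J K) : ℝ) + #(notSqfree A B M a I J K)
      = I * (J * K) := by exact_mod_cast hsplit
  -- Of the whole box, at most `1/2 + 1/4` is lost.
  linarith

/-! ### The counting function and explicit triples -/

lemma Q_intCast (A B u v w : ℤ) : Q A B (u : ℝ) (v : ℝ) (w : ℝ) = ((Q A B u v w : ℤ) : ℝ) := by
  simp only [Q, F, Int.cast_id]; push_cast; ring

/-- With `Q = d` fixed, the height condition bounds every coordinate. Finiteness matters because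
`Set.ncard` is 0 on infinite sets. -/
lemma finite_points (A B : ℤ) (c₁ c₂ α : ℝ) (d : ℕ) : {t : ℤ × ℤ × ℤ |
    ((t.1 : ℝ), (t.2.1 : ℝ), (t.2.2 : ℝ)) ∈ region A B c₁ c₂ α ∧
      Q A B t.1 t.2.1 t.2.2 = (d : ℤ)}.Finite := by
  set N : ℤ := ⌊Real.exp (-2 * c₂) * (d : ℝ) ^ (1 / 4 + 2 * α)⌋ with hN
  refine ((Set.finite_Icc 1 N).prod ((Set.finite_Icc 1 N).prod (Set.finite_Icc 1 N))).subset ?_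
  rintro ⟨u, v, w⟩ ⟨⟨hu, hv, hw, -, -, hmax⟩, hQ⟩
  simp only at hu hv hw hmax hQ
  rw [Q_intCast, hQ, Int.cast_natCast] at hmax
  have h1 := (le_max_left _ _).trans hmax
  have h2 := (le_max_right _ _).trans hmax
  have hv' : (v : ℝ) ≤ v * w ^ 2 := le_mul_of_one_le_right (by linarith) (one_le_pow₀ hw)
  have hw' : (w : ℝ) ≤ v * w ^ 2 :=
    (le_self_pow₀ hw two_ne_zero).trans (le_mul_of_one_le_left (by positivity) hv)
  simp only [Set.mem_prod, Set.mem_Icc]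
  refine ⟨⟨by exact_mod_cast hu, Int.le_floor.2 h1⟩, ⟨by exact_mod_cast hv,
    Int.le_floor.2 (hv'.trans h2)⟩, by exact_mod_cast hw, Int.le_floor.2 (hw'.trans h2)⟩

lemma card_le_SQ {A B : ℤ} {c₁ c₂ α X : ℝ} {a : ZMod (4 * conductor (curve A B))}
    (G : Finset (ℤ × ℤ × ℤ))
    (hreg : ∀ t ∈ G, ((t.1 : ℝ), (t.2.1 : ℝ), (t.2.2 : ℝ)) ∈ region A B c₁ c₂ α)
    (hsq : ∀ t ∈ G, Squarefree (Q A B t.1 t.2.1 t.2.2))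
    (hX : ∀ t ∈ G, ((Q A B t.1 t.2.1 t.2.2 : ℤ) : ℝ) ≤ X)
    (ha : ∀ t ∈ G, ((Q A B t.1 t.2.1 t.2.2 : ℤ) : ZMod (4 * conductor (curve A B))) = a) :
    #G ≤ SQ A B c₁ c₂ a α X := by
  classical
  have hpos : ∀ t ∈ G, 0 < Q A B t.1 t.2.1 t.2.2 := fun t ht => by
    have := (hreg t ht).2.2.2.1
    rw [Q_intCast] at this
    exact_mod_cast this
  have hnat : ∀ t ∈ G, ((Q A B t.1 t.2.1 t.2.2).natAbs : ℤ) = Q A B t.1 t.2.1 t.2.2 :=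
    fun t ht => Int.natAbs_of_nonneg (hpos t ht).le
  rw [SQ, card_eq_sum_card_fiberwise (f := fun t => (Q A B t.1 t.2.1 t.2.2).natAbs)
    (t := (Icc 1 ⌊X⌋₊).filter fun d : ℕ => Squarefree d ∧
      (d : ZMod (4 * conductor (curve A B))) = a)]
  · refine sum_le_sum fun d _ => ?_
    rw [rQ, ← Set.ncard_coe_finset]
    refine Set.ncard_le_ncard (fun t ht => ?_) (finite_points A B c₁ c₂ α d)
    obtain ⟨h1, h2⟩ := mem_filter.1 (mem_coe.1 ht)
    exact ⟨hreg t h1, by rw [← h2, hnat t h1]⟩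
  · intro t ht
    have ht := mem_coe.1 ht
    refine mem_coe.2 (mem_filter.2 ⟨mem_Icc.2 ⟨Int.natAbs_pos.2 (hpos t ht).ne', ?_⟩, ?_, ?_⟩)
    · refine Nat.le_floor ?_
      have h := hX t ht
      rwa [← hnat t ht, Int.cast_natCast] at h
    · exact Int.squarefree_natAbs.2 (hsq t ht)
    · rw [← ha t ht]
      conv_rhs => rw [← hnat t ht]
      rw [Int.cast_natCast]

/-! ### Choice of the boxes -/

lemma exists_forall_le_rpow {e : ℝ} (he : 0 < e) (c : ℝ) : ∃ X₀ : ℝ, ∀ X ≥ X₀, c ≤ X ^ e :=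
  Filter.eventually_atTop.1 ((tendsto_rpow_atTop he).eventually_ge_atTop c)

lemma rpow_pow_eq {X : ℝ} (hX : 0 ≤ X) (e : ℝ) (n : ℕ) : (X ^ e) ^ n = X ^ (e * n) := by
  rw [Real.rpow_mul hX, Real.rpow_natCast]

/-- Lengths `I`, `K` that go with a given length `J`. -/
lemma exists_lengths {α T M R : ℝ} (c₁ c₂ : ℝ) (hα₀ : 0 < α) (hα₁ : α < 1 / 56) (hT : 1 ≤ T)
    (hM : 1 ≤ M) (hR : 1 ≤ R) :
    ∃ X₀ : ℝ, ∀ X ≥ X₀, ∀ J : ℕ, X ^ (1 / 4 - 2 * α) ≤ J → (J : ℝ) ≤ X ^ (1 / 4 - α) →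
      ∃ I K : ℕ, T ≤ I ∧ T ≤ J ∧ T ≤ K ∧ T * I ≤ (J : ℝ) ^ 2 ∧ R * J * K ^ 2 ≤ I ∧
        162 * M ^ 4 * J * I ^ 3 ≤ X ∧ √(X / (32 * (162 * M ^ 4) * R)) ≤ I * J * K ∧
        Real.exp (-2 * c₁) ≤ I ∧
        3 * M * I ≤ Real.exp (-2 * c₂) * (M ^ 4 * J * I ^ 3 / 2) ^ (1 / 4 + 2 * α) := by
  set c := 162 * M ^ 4 with hc
  have hc1 : 1 ≤ c := by
    have : 1 ≤ M ^ 4 := one_le_pow₀ hM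
    linarith
  obtain ⟨X₁, h₁⟩ := exists_forall_le_rpow (by linarith : 0 < 4 * α) ((8 * R * T ^ 2) ^ 3 * c)
  obtain ⟨X₂, h₂⟩ := exists_forall_le_rpow (by linarith : 0 < 1 / 4 - 2 * α)
    (max T (Real.exp (-2 * c₁)))
  obtain ⟨X₃, h₃⟩ := exists_forall_le_rpow (by linarith : 0 < 3 / 4 - 14 * α) (T ^ 3)
  obtain ⟨X₄, h₄⟩ := exists_forall_le_rpow (by linarith : 0 < 4 * α / 3)
    (3 * M * Real.exp (2 * c₂) * 2592 ^ (1 / 4 + 2 * α))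
  refine ⟨max 1 (max (max X₁ X₂) (max X₃ X₄)), fun X hX J hJl hJu => ?_⟩
  simp only [ge_iff_le, max_le_iff] at hX
  obtain ⟨hX1, ⟨hX₁, hX₂⟩, hX₃, hX₄⟩ := hX
  specialize h₁ X hX₁
  specialize h₂ X hX₂
  specialize h₃ X hX₃
  specialize h₄ X hX₄
  have hX0 : 0 < X := by linarith
  have hJT : max T (Real.exp (-2 * c₁)) ≤ J := h₂.trans hJl
  have hJ1 : (1 : ℝ) ≤ J := hT.trans ((le_max_left _ _).trans hJT)
  have hJ0 : (0 : ℝ) < J := by linarith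
  -- The real solution of `c J Y³ = X`, where `c J I³` is the upper bound for `Q` in `valQ_bounds`.
  set Y := (X / (c * J)) ^ (1 / 3 : ℝ) with hY
  have hY0 : 0 ≤ Y := by positivity
  have hY3 : Y ^ 3 = X / (c * J) := by
    rw [hY, rpow_pow_eq (by positivity)]; norm_num
  have hXsplit : X = X ^ (1 - 4 * α) * X ^ (4 * α) := by
    rw [← Real.rpow_add hX0]; norm_num
  -- The upper bound on `J` is used here: it makes `I / J` large, leaving room for `K ≥ T`.
  have hYJ : 8 * R * T ^ 2 * J ≤ Y := by
    rw [← pow_le_pow_iff_left₀ (by positivity) hY0 (three_ne_zero), hY3,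
      le_div_iff₀ (by positivity)]
    have hJ4 : (J : ℝ) ^ 4 ≤ X ^ (1 - 4 * α) := by
      calc (J : ℝ) ^ 4 ≤ (X ^ (1 / 4 - α)) ^ 4 := by gcongr
        _ = X ^ (1 - 4 * α) := by rw [rpow_pow_eq hX0.le]; congr 1; push_cast; ring
    calc (8 * R * T ^ 2 * J) ^ 3 * (c * J) = J ^ 4 * ((8 * R * T ^ 2) ^ 3 * c) := by ring
      _ ≤ X ^ (1 - 4 * α) * X ^ (4 * α) := by gcongr
      _ = X := hXsplit.symm
  have hRT : 1 ≤ R * T ^ 2 := one_le_mul_of_one_le_of_one_le hR (one_le_pow₀ hT)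
  have hRTJ : (J : ℝ) ≤ R * T ^ 2 * J := le_mul_of_one_le_left hJ0.le hRT
  have hY2 : 2 ≤ Y := by linarith
  set I := ⌊Y⌋₊ with hI
  have hIY : (I : ℝ) ≤ Y := Nat.floor_le hY0
  have hYI : Y / 2 ≤ I := by
    have := Nat.lt_floor_add_one Y
    linarith
  have hI0 : (0 : ℝ) < I := by linarith
  have hIJ : 4 * R * T ^ 2 * J ≤ I := by linarith
  -- The largest real `K` allowed by `R J K² ≤ I`.
  set s := √(I / (R * J)) with hs
  have hs2 : s ^ 2 = I / (R * J) := Real.sq_sqrt (by positivity)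
  have hs0 : 0 ≤ s := Real.sqrt_nonneg _
  have hsT : 2 * T ≤ s := by
    refine Real.le_sqrt_of_sq_le ?_
    rw [le_div_iff₀ (by positivity)]
    linarith
  set K := ⌊s⌋₊ with hK
  have hKs : (K : ℝ) ≤ s := Nat.floor_le hs0
  have hsK : s / 2 ≤ K := by
    have := Nat.lt_floor_add_one s
    linarith
  have hJI : J * X ≤ J * (8 * c * (J * I ^ 3)) := by
    have h : Y ^ 3 ≤ (2 * I) ^ 3 := by gcongr; linarith
    rw [hY3, div_le_iff₀ (by positivity)] at h
    nlinarith
  have hXI : X ≤ 8 * c * (J * I ^ 3) := le_of_mul_le_mul_left hJI hJ0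
  have hJle : (J : ℝ) ≤ I := by linarith
  refine ⟨I, K, ((le_max_left _ _).trans hJT).trans hJle, (le_max_left _ _).trans hJT,
    by linarith, ?_, ?_, ?_, ?_, ((le_max_right _ _).trans hJT).trans hJle, ?_⟩
  -- After cubing, this amounts to `T³ X ≤ c J⁷`, which follows from `J ≥ X^(1/4-2α)` as `7/4 - 14α
  -- > 1`.
  · refine (mul_le_mul_of_nonneg_left hIY (by linarith)).trans ?_
    rw [← pow_le_pow_iff_left₀ (by positivity) (by positivity) (three_ne_zero), mul_pow, hY3,
      mul_div_assoc', div_le_iff₀ (by positivity)]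
    have hJ7 : X * X ^ (3 / 4 - 14 * α) ≤ (J : ℝ) ^ 7 := by
      calc X * X ^ (3 / 4 - 14 * α) = X ^ (1 : ℝ) * X ^ (3 / 4 - 14 * α) := by rw [Real.rpow_one]
        _ = (X ^ (1 / 4 - 2 * α)) ^ 7 := by
          rw [← Real.rpow_add hX0, rpow_pow_eq hX0.le]; congr 1; push_cast; ring
        _ ≤ J ^ 7 := by gcongr
    calc T ^ 3 * X ≤ X ^ (3 / 4 - 14 * α) * X := by gcongr
      _ ≤ 1 * J ^ 7 := by linarith
      _ ≤ c * J ^ 7 := by gcongr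
      _ = _ := by ring
  · have h : (K : ℝ) ^ 2 ≤ I / (R * J) := hs2 ▸ (by gcongr : (K : ℝ) ^ 2 ≤ s ^ 2)
    rw [le_div_iff₀ (by positivity)] at h
    linarith
  · have h : (I : ℝ) ^ 3 ≤ X / (c * J) := hY3 ▸ (by gcongr : (I : ℝ) ^ 3 ≤ Y ^ 3)
    rw [le_div_iff₀ (by positivity)] at h
    linarith
  · refine Real.sqrt_le_iff.2 ⟨by positivity, ?_⟩
    have h : (I * J * (s / 2)) ^ 2 ≤ (I * J * K : ℝ) ^ 2 := by gcongr
    refine le_trans ?_ h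
    rw [mul_pow, div_pow, hs2, div_le_iff₀ (by positivity)]
    have e : (I * J : ℝ) ^ 2 * (I / (R * J) / 2 ^ 2) * (32 * c * R) = 8 * c * (J * I ^ 3) := by
      field_simp; ring
    rw [e]; exact hXI
  -- The height condition: `Q ≥ X / 2592`, with `2592 = 2 * 8 * 162`, and the spare factor
  -- `X^(4α/3)` absorbs all constants.
  · have hYX : Y ≤ X ^ (1 / 4 + 2 * α / 3) := by
      rw [← pow_le_pow_iff_left₀ hY0 (by positivity) (three_ne_zero), hY3, rpow_pow_eq hX0.le,
        div_le_iff₀ (by positivity)]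
      calc X = X ^ ((1 / 4 + 2 * α / 3) * (3 : ℕ)) * (1 * X ^ (1 / 4 - 2 * α)) := by
            rw [one_mul, ← Real.rpow_add hX0]
            conv_lhs => rw [← Real.rpow_one X]
            congr 1; push_cast; ring
        _ ≤ X ^ ((1 / 4 + 2 * α / 3) * (3 : ℕ)) * (c * J) := by gcongr
    have hlow : X / 2592 ≤ M ^ 4 * J * I ^ 3 / 2 := by
      rw [hc] at hXI
      linarith
    calc 3 * M * I ≤ 3 * M * X ^ (1 / 4 + 2 * α / 3) := by gcongr; exact hIY.trans hYX
      _ = Real.exp (-2 * c₂) * (X ^ (1 / 4 + 2 * α / 3) *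
          (3 * M * Real.exp (2 * c₂) * 2592 ^ (1 / 4 + 2 * α)) / 2592 ^ (1 / 4 + 2 * α)) := by
          field_simp
          rw [Real.exp_neg]
          field_simp
      _ ≤ Real.exp (-2 * c₂) * (X ^ (1 / 4 + 2 * α / 3) * X ^ (4 * α / 3)
          / 2592 ^ (1 / 4 + 2 * α)) := by gcongr
      _ = Real.exp (-2 * c₂) * (X / 2592) ^ (1 / 4 + 2 * α) := by
          rw [Real.div_rpow hX0.le (by norm_num), ← Real.rpow_add hX0]
          rw [show 1 / 4 + 2 * α / 3 + 4 * α / 3 = 1 / 4 + 2 * α by ring]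
      _ ≤ _ := by gcongr

/-- Exponents of the powers of two between `X ^ (1 / 4 - 2 α)` and `X ^ (1 / 4 - α)`. -/
lemma exists_dyadic {α : ℝ} (hα₀ : 0 < α) (hα₁ : α < 1 / 56) : ∃ X₀ : ℝ, ∀ X ≥ X₀, ∃ D : Finset ℕ,
    (∀ m ∈ D, X ^ (1 / 4 - 2 * α) ≤ ((2 ^ m : ℕ) : ℝ) ∧ ((2 ^ m : ℕ) : ℝ) ≤ X ^ (1 / 4 - α)) ∧
    α / 2 * Real.log X ≤ #D := by
  refine ⟨Real.exp (2 / α) + 1, fun X hX => ?_⟩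
  have hX0 : 0 < X := by have := Real.exp_pos (2 / α); linarith
  have hlog : 2 / α ≤ Real.log X := (Real.le_log_iff_exp_le hX0).2 (by linarith)
  have hlog' : 2 ≤ Real.log X * α := (div_le_iff₀ hα₀).1 hlog
  have hlog0 : 0 ≤ Real.log X := le_trans (by positivity) hlog
  set l := Real.logb 2 X with hl
  have hll : Real.log X ≤ l := by
    rw [hl, Real.logb, le_div_iff₀ (Real.log_pos (by norm_num))]
    have : Real.log 2 ≤ 1 := by linarith [Real.log_two_lt_d9]
    nlinarith
  have hXl : X = 2 ^ l := (Real.rpow_logb (by norm_num) (by norm_num) hX0).symm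
  have hXe : ∀ e : ℝ, X ^ e = 2 ^ (l * e) := fun e => by
    rw [Real.rpow_mul (by norm_num), ← hXl]
  have hpow : ∀ m : ℕ, ((2 ^ m : ℕ) : ℝ) = 2 ^ (m : ℝ) := fun m => by
    rw [Real.rpow_natCast]; push_cast; rfl
  have hu0 : 0 ≤ l * (1 / 4 - α) := mul_nonneg (hlog0.trans hll) (by linarith)
  have hl0 : 0 ≤ l * (1 / 4 - 2 * α) := mul_nonneg (hlog0.trans hll) (by linarith)
  -- The exponents fill an interval of length `α l ≥ α log X`. Rounding loses at most 1, which is at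
  -- most half of this since `α log X ≥ 2`.
  refine ⟨Icc ⌈l * (1 / 4 - 2 * α)⌉₊ ⌊l * (1 / 4 - α)⌋₊, fun m hm => ?_, ?_⟩
  · rw [mem_Icc] at hm
    rw [hXe, hXe, hpow]
    exact ⟨Real.rpow_le_rpow_of_exponent_le (by norm_num) (Nat.ceil_le.1 hm.1),
      Real.rpow_le_rpow_of_exponent_le (by norm_num) ((Nat.le_floor_iff hu0).1 hm.2)⟩
  · rw [Nat.card_Icc]
    have h1 : ((⌊l * (1 / 4 - α)⌋₊ + 1 : ℕ) : ℝ) - (⌈l * (1 / 4 - 2 * α)⌉₊ : ℕ) ≤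
        ((⌊l * (1 / 4 - α)⌋₊ + 1 - ⌈l * (1 / 4 - 2 * α)⌉₊ : ℕ) : ℝ) := by
      rw [sub_le_iff_le_add]
      exact_mod_cast le_tsub_add
    have h2 := Nat.lt_floor_add_one (l * (1 / 4 - α))
    have h3 := Nat.ceil_lt_add_one hl0
    push_cast at h1
    nlinarith

/-- The point `(u, v, w)` with indices `t`. -/
def point (M a : ℕ) (t : ℕ × ℕ × ℕ) : ℤ × ℤ × ℤ :=
  (term M 1 t.1, term M a t.2.1, term M 0 t.2.2)

lemma point_injective {M : ℕ} (hM : 0 < M) (a : ℕ) : Function.Injective (point M a) := by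
  intro t t' h
  simp only [point, Prod.mk.injEq] at h
  exact Prod.ext (term_injective hM _ h.1)
    (Prod.ext (term_injective hM _ h.2.1) (term_injective hM _ h.2.2))

/-! ### The points of a box lie in the region -/

section Box

variable {A B : ℤ} {M a I J K : ℕ} {t : ℕ × ℕ × ℕ}

lemma valQ_bounds (hM : 0 < M) (ha : a ≤ M) (hI : 0 < I) (hJ : 0 < J)
    (hdom : 3 * domConst A B * M ^ 2 * J * K ^ 2 ≤ I) (ht : t ∈ box I J K) :
    (M : ℤ) ^ 4 * J * I ^ 3 ≤ 2 * valQ A B M a t ∧ valQ A B M a t ≤ 162 * M ^ 4 * J * I ^ 3 := by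
  obtain ⟨⟨h1, h1'⟩, ⟨h2, h2'⟩, -⟩ := mem_box.1 ht
  obtain ⟨hu, hv, -⟩ := term_pos_of_mem_box (a := a) hM hJ ht
  obtain ⟨hF, hF'⟩ := F_bounds_of_mem_box hM ha hJ hdom ht
  have hF0 := F_pos_of_mem_box hM ha hJ hdom ht
  have u1 := le_term (M := M) (c := 1) h1
  have u2 := term_le (c := 1) hM h1' hI
  have v1 := le_term (M := M) (c := a) h2
  have v2 := term_le ha h2' hJ
  rw [valQ_eq]
  constructor
  · calc (M : ℤ) ^ 4 * J * I ^ 3 = (M * J) * (M * I) ^ 3 := by ring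
      _ ≤ term M a t.2.1 * term M 1 t.1 ^ 3 := by gcongr
      _ ≤ term M a t.2.1 * (2 * F A B (term M 1 t.1) (term M a t.2.1 * term M 0 t.2.2 ^ 2)) := by
        gcongr
      _ = _ := by ring
  · calc _ ≤ (3 * M * J) * (2 * (3 * M * I) ^ 3 : ℤ) := by
          gcongr
          refine hF'.trans ?_
          gcongr
      _ = _ := by ring

/-- Since `v w² ≤ u` on the box, the maximum in the height condition is `u`, between `M I` and `3 M
I`. -/
lemma point_mem_region {c₁ c₂ α : ℝ} (hα : 0 < α) (hM : 0 < M) (ha : a ≤ M) (hI : 0 < I)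
    (hJ : 0 < J) (hdom : 3 * domConst A B * M ^ 2 * J * K ^ 2 ≤ I) (h₁ : Real.exp (-2 * c₁) ≤ I)
    (h₂ : 3 * M * I ≤ Real.exp (-2 * c₂) * ((M : ℝ) ^ 4 * J * I ^ 3 / 2) ^ (1 / 4 + 2 * α))
    (ht : t ∈ box I J K) :
    (((point M a t).1 : ℝ), ((point M a t).2.1 : ℝ), ((point M a t).2.2 : ℝ)) ∈
      region A B c₁ c₂ α := by
  obtain ⟨⟨h1, h1'⟩, -⟩ := mem_box.1 ht
  obtain ⟨hu, hv, hw⟩ := term_pos_of_mem_box (a := a) hM hJ ht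
  have hlow := (valQ_bounds hM ha hI hJ hdom ht).1
  have hlow' : (M : ℝ) ^ 4 * J * I ^ 3 / 2 ≤ (valQ A B M a t : ℝ) := by
    rw [div_le_iff₀ two_pos, mul_comm _ (2 : ℝ)]; exact_mod_cast hlow
  have hpos : (0 : ℝ) < M ^ 4 * J * I ^ 3 / 2 := by positivity
  have u1 : (M : ℝ) * I ≤ term M 1 t.1 := by exact_mod_cast le_term (M := M) (c := 1) h1
  have u2 : (term M 1 t.1 : ℝ) ≤ 3 * M * I := by exact_mod_cast term_le (c := 1) hM h1' hI
  have hL := domConst_ge A B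
  have hz : term M a t.2.1 * term M 0 t.2.2 ^ 2 ≤ term M 1 t.1 := by
    refine le_trans ?_ (dom_of_mem_box hM ha hJ hdom ht)
    refine le_mul_of_one_le_left (by positivity) (by linarith)
  have hz' : (term M a t.2.1 * term M 0 t.2.2 ^ 2 : ℝ) ≤ term M 1 t.1 := by exact_mod_cast hz
  have hM1 : (1 : ℝ) ≤ M := by exact_mod_cast hM
  simp only [region, Set.mem_ofPred_eq, point, Q_intCast, max_eq_left hz']
  change _ ∧ _ ∧ _ ∧ 0 < (valQ A B M a t : ℝ) ∧ _ ∧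
    _ ≤ _ * (valQ A B M a t : ℝ) ^ (1 / 4 + 2 * α)
  refine ⟨by exact_mod_cast hu, by exact_mod_cast hv, by exact_mod_cast hw, by linarith, ?_, ?_⟩
  · refine (h₁.trans ?_).trans u1
    exact le_mul_of_one_le_left (by positivity) hM1
  · refine (u2.trans h₂).trans ?_
    gcongr

end Box

/-- No information on the exponents is needed: `finprod` is either a finite product of prime powers
or the default value 1. -/
lemma conductor_ne_zero (E : WeierstrassCurve ℚ) : conductor E ≠ 0 :=
  finprod_induction (· ≠ 0) one_ne_zero (fun _ _ => mul_ne_zero)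
    fun p => pow_ne_zero _ p.2.ne_zero

lemma exists_coprime_lift {n M : ℕ} [NeZero M] (h : n ∣ M) (a : (ZMod n)ˣ) :
    ∃ b : ℕ, b ≤ M ∧ Nat.Coprime b M ∧ (b : ZMod n) = a := by
  obtain ⟨b, rfl⟩ := ZMod.unitsMap_surjective h a
  refine ⟨(b : ZMod M).val, (ZMod.val_lt _).le, ZMod.val_coe_unit_coprime b, ?_⟩
  rw [ZMod.natCast_val, ZMod.unitsMap_val]

/-- The lower bound for `SQ`. -/
theorem exists_SQ_ge (A B : ℤ) (hAB : 4 * A ^ 3 + 27 * B ^ 2 ≠ 0) (c₁ c₂ : ℝ)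
    (α : ℝ) (hα₀ : 0 < α) (hα₁ : α < 1 / 56) :
    ∃ C : ℝ, 0 < C ∧ ∃ X₀ : ℝ,
      ∀ a : (ZMod (4 * conductor (curve A B)))ˣ,
        ∀ X : ℝ, X₀ ≤ X →
          C * (X ^ (1 / 2 : ℝ) * Real.log X) ≤
            (SQ A B c₁ c₂ (a : ZMod _) α X : ℝ) := by
  classical
  set n := 4 * conductor (curve A B) with hn
  -- The factors control the residue class, the primes with multiple roots, and the primes up to 12.
  -- `M` does not depend on `a`, so neither do the constants.
  set M := n * (4 * A ^ 3 + 27 * B ^ 2).natAbs * Nat.factorial 12 with hMdef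
  have hM : 0 < M := Nat.mul_pos (Nat.mul_pos (Nat.mul_pos four_pos
    (Nat.pos_of_ne_zero (conductor_ne_zero _))) (Int.natAbs_pos.2 hAB)) (Nat.factorial_pos _)
  have : NeZero M := ⟨hM.ne'⟩
  have hnM : n ∣ M := (Dvd.intro _ rfl).trans (Dvd.intro _ rfl)
  have hDM : 4 * A ^ 3 + 27 * B ^ 2 ∣ (M : ℤ) :=
    Int.dvd_natCast.2 ((Dvd.intro_left _ rfl).trans (Dvd.intro _ rfl))
  have hM1 : (1 : ℝ) ≤ M := by exact_mod_cast hM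
  have hL := domConst_ge A B
  set R : ℝ := 3 * domConst A B * M ^ 2 with hR
  have hR1 : 1 ≤ R := by
    have h1 : (2 : ℝ) ≤ domConst A B := by exact_mod_cast hL
    have h2 : (1 : ℝ) ≤ (M : ℝ) ^ 2 := one_le_pow₀ hM1
    rw [hR]; nlinarith
  obtain ⟨T, hT1, hT⟩ := exists_card_sqfreeTriples_ge A B hM (Dvd.intro_left _ rfl) hDM
  obtain ⟨X₁, h₁⟩ := exists_lengths c₁ c₂ hα₀ hα₁ hT1 hM1 hR1
  obtain ⟨X₂, h₂⟩ := exists_dyadic hα₀ hα₁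
  set δ : ℝ := √(1 / (32 * (162 * (M : ℝ) ^ 4) * R)) with hδ
  have hδ0 : 0 < δ := Real.sqrt_pos.2 (by positivity)
  refine ⟨α / 2 * (δ / 4), by positivity, max 0 (max X₁ X₂), fun a X hX => ?_⟩
  simp only [max_le_iff] at hX
  obtain ⟨hX0, hX₁, hX₂⟩ := hX
  obtain ⟨b, hb, hbM, hba⟩ := exists_coprime_lift hnM a
  obtain ⟨D, hD, hcard⟩ := h₂ X hX₂
  have hlen := fun (m : ℕ) (hm : m ∈ D) => h₁ X hX₁ (2 ^ m) (hD m hm).1 (hD m hm).2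
  choose! I K hI hJ hK hskew hdom hup hlow hexp hreg using hlen
  have hdom' : ∀ m ∈ D, 3 * domConst A B * M ^ 2 * (2 ^ m : ℕ) * K m ^ 2 ≤ (I m : ℤ) := by
    intro m hm
    have := hdom m hm
    rw [hR] at this
    exact_mod_cast this
  have hI0 : ∀ m ∈ D, 0 < I m := fun m hm => by
    have : (0 : ℝ) < I m := by linarith [hI m hm]
    exact_mod_cast this
  set S : ℕ → Finset (ℕ × ℕ × ℕ) := fun m => sqfreeTriples A B M b (I m) (2 ^ m) (K m) with hS
  have hmem : ∀ p ∈ (D.biUnion S).image (point M b), ∃ m ∈ D, ∃ t ∈ box (I m) (2 ^ m) (K m),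
      Squarefree (valQ A B M b t) ∧ point M b t = p := by
    intro p hp
    obtain ⟨t, ht, rfl⟩ := mem_image.1 hp
    obtain ⟨m, hm, ht⟩ := mem_biUnion.1 ht
    exact ⟨m, hm, t, (mem_filter.1 ht).1, (mem_filter.1 ht).2, rfl⟩
  have hle : #((D.biUnion S).image (point M b)) ≤ SQ A B c₁ c₂ (a : ZMod n) α X := by
    refine card_le_SQ _ ?_ ?_ ?_ ?_ <;> intro p hp <;> obtain ⟨m, hm, t, ht, hsq, rfl⟩ := hmem p hp
    · exact point_mem_region hα₀ hM hb (hI0 m hm) (by positivity) (hdom' m hm) (hexp m hm)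
        (hreg m hm) ht
    · exact hsq
    · refine le_trans ?_ (hup m hm)
      exact_mod_cast (valQ_bounds hM hb (hI0 m hm) (by positivity) (hdom' m hm) ht).2
    · have h : (n : ℤ) ∣ valQ A B M b t - b :=
        (Int.natCast_dvd_natCast.2 hnM).trans (valQ_modEq A B M b t)
      rw [← ZMod.intCast_zmod_eq_zero_iff_dvd] at h
      push_cast at h
      rw [← hba]
      exact sub_eq_zero.1 h
  -- The ranges `[2^m, 2^(m+1))` of the index of `v` are disjoint.
  have hdisj : (D : Set ℕ).PairwiseDisjoint S := by
    intro m _ m' _ hne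
    refine disjoint_left.2 fun t ht ht' => hne ?_
    have h1 := (mem_box.1 (mem_filter.1 ht).1).2.1
    have h2 := (mem_box.1 (mem_filter.1 ht').1).2.1
    have h3 : m < m' + 1 := (Nat.pow_lt_pow_iff_right one_lt_two).1 (by rw [pow_succ]; omega)
    have h4 : m' < m + 1 := (Nat.pow_lt_pow_iff_right one_lt_two).1 (by rw [pow_succ]; omega)
    omega
  rw [card_image_of_injective _ (point_injective hM b), card_biUnion hdisj] at hle
  have hsqrt : √(X / (32 * (162 * (M : ℝ) ^ 4) * R)) = δ * √X := by
    rw [hδ, ← Real.sqrt_mul (by positivity)]; congr 1; ring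
  have hSm : ∀ m ∈ D, δ / 4 * √X ≤ #(S m) := by
    intro m hm
    have h := hT b (I m) (2 ^ m) (K m) hb hbM (hI m hm) (hJ m hm) (hK m hm) (hskew m hm)
      (hdom' m hm)
    have h' := hlow m hm
    rw [hsqrt] at h'
    linarith
  calc α / 2 * (δ / 4) * (X ^ (1 / 2 : ℝ) * Real.log X)
      = (α / 2 * Real.log X) * (δ / 4 * √X) := by rw [Real.sqrt_eq_rpow]; ring
    _ ≤ #D * (δ / 4 * √X) := by gcongr
    _ = ∑ m ∈ D, δ / 4 * √X := by rw [sum_const, nsmul_eq_mul]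
    _ ≤ ∑ m ∈ D, (#(S m) : ℝ) := sum_le_sum hSm
    _ ≤ _ := by exact_mod_cast hle

end SquarefreeTwist

theorem proposition6 (A B : ℤ) (hAB : 4 * A ^ 3 + 27 * B ^ 2 ≠ 0) (c₁ c₂ : ℝ)
    (α : ℝ) (hα₀ : 0 < α) (hα₁ : α < 1 / 56) :
    ∃ C : ℝ, 0 < C ∧ ∃ X₀ : ℝ,
      ∀ a : (ZMod (4 * SquarefreeTwist.conductor (SquarefreeTwist.curve A B)))ˣ,
        ∀ X : ℝ, X₀ ≤ X →
          C * (X ^ (1 / 2 : ℝ) * Real.log X) ≤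
            (SquarefreeTwist.SQ A B c₁ c₂ (a : ZMod _) α X : ℝ) :=
  SquarefreeTwist.exists_SQ_ge A B hAB c₁ c₂ α hα₀ hα₁
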